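/- Let $K$ be a field, $S=K[x_1,\dots,x_n]$ and $\mathfrak m=(x_1,\dots,x_n)$. An ideal $I\subseteq S$ generated by squarefree monomials is called a squarefree Borel ideal if for every squarefree monomial $u\in I$, every $x_j$ dividing $u$ and every $i<j$ such that $x_i(u/x_j)$ is squarefree, one has $x_i(u/x_j)\in I$. It is called equigenerated if all its minimal monomial generators have the same degree. For a monomial ideal $I$ with minimal multigraded free resolution $0\to F_q\to\cdots\to F_1\to F_0\to I\to 0$, $F_i=\bigoplus_{j=1}^{b_i}S(-\mathbf a_{ij})$, the $k$-th homological shift ideal is $\mathrm{HS}_k(I)=(\mathbf x^{\mathbf a_{kj}} : j=1,\dots,b_k)$ (so $\mathrm{HS}_0(I)=I$, and $\mathrm{HS}_k(I)=0$ if $F_k=0$). The analytic spread $\ell(J)$ of an ideal $J$ is the Krull dimension of the fiber ring $\mathcal R(J)/\mathfrak m\mathcal R(J)=\bigoplus_{r\ge 0}J^r/\mathfrak mJ^r$ (so $\ell(0)=0$); conventionally, $\mathrm{height}(0)=0$ and $\mathrm{height}(S)=\infty$. Let $I\subseteq S$ be an equigenerated squarefree Borel ideal. Then for all integers $k\ge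 0$, $$\mathrm{height}(\mathrm{HS}_{k+1}(I))\le \mathrm{height}(\mathrm{HS}_k(I))\qquad\text{and}\qquad \ell(\mathrm{HS}_{k+1}(I))\le \ell(\mathrm{HS}_k(I)).$$ -/

import Mathlib

open MvPolynomial

/-- The exponent vector `u` (i.e. the monomial `x^u`) is `k`-bounded: all exponents are `≤ k`.
The `1`-bounded monomials are the squarefree ones. -/
def IsKBounded {n : ℕ} (k : ℕ) (u : Fin n →₀ ℕ) : Prop :=
  ∀ i, u i ≤ k

/-- `k`-Borel ideals of `K[x_1,…,x_n]`: monomial ideals generated by `k`-bounded monomials such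
that for each `k`-bounded monomial `u ∈ I`, `j ∈ supp u` and `i < j`, the monomial `x_i (u / x_j)`
lies in `I` provided it is `k`-bounded. -/
structure IsKBorel {K : Type*} [Field K] {n : ℕ} (k : ℕ) (I : Ideal (MvPolynomial (Fin n) K)) :
    Prop where
  generated : ∃ U : Set (Fin n →₀ ℕ), (∀ u ∈ U, IsKBounded k u) ∧
    I = Ideal.span ((fun u => (monomial u (1 : K) : MvPolynomial (Fin n) K)) '' U)
  exchange : ∀ u : Fin n →₀ ℕ, IsKBounded k u → (monomial u (1 : K)) ∈ I →
    ∀ j ∈ u.support, ∀ i < j,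
      IsKBounded k (u - Finsupp.single j 1 + Finsupp.single i 1) →
        monomial (u - Finsupp.single j 1 + Finsupp.single i 1) (1 : K) ∈ I

/-- Squarefree Borel ideals are the `1`-Borel ideals. -/
def IsSquarefreeBorel {K : Type*} [Field K] {n : ℕ} (I : Ideal (MvPolynomial (Fin n) K)) : Prop :=
  IsKBorel 1 I

/-- The exponent vectors of the elements of `G(I)`: the monomials in `I` that are minimal with
respect to divisibility. For a monomial ideal they form its unique minimal set of monomial
generators. -/
def minimalMonomials {K : Type*} [Field K] {n : ℕ} (I : Ideal (MvPolynomial (Fin n) K)) :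
    Set (Fin n →₀ ℕ) :=
  {u | Minimal (fun v : Fin n →₀ ℕ => monomial v (1 : K) ∈ I) u}

/-- `I` is equigenerated: all elements of `G(I)` have the same degree. -/
def IsEquigenerated {K : Type*} [Field K] {n : ℕ} (I : Ideal (MvPolynomial (Fin n) K)) : Prop :=
  ∃ d : ℕ, ∀ u ∈ minimalMonomials I, u.degree = d

/-- A minimal multigraded free resolution
`0 → F_q → ⋯ → F_1 → F_0 → I → 0` of an ideal `I` of `S = K[x_1,…,x_n]`, where
`F_i = ⨁_j S(-a_{ij})` has the homogeneous basis `e_{i,j}` of multidegree `a_{ij} = shift i j`.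
The maps are given by their matrices with respect to these bases. -/
structure MinimalMultigradedResolution {K : Type*} [Field K] {n : ℕ}
    (I : Ideal (MvPolynomial (Fin n) K)) where
  /-- the rank `b_i` of `F_i` -/
  rank : ℕ → ℕ
  /-- the multigraded shifts `a_{ij}` -/
  shift : ∀ i, Fin (rank i) → (Fin n →₀ ℕ)
  /-- the images of the basis elements of `F_0` under the augmentation `F_0 → I` -/
  aug : Fin (rank 0) → MvPolynomial (Fin n) K
  /-- the matrix of the differential `F_{i+1} → F_i` -/
  d : ∀ i, Matrix (Fin (rank i)) (Fin (rank (i + 1))) (MvPolynomial (Fin n) K)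
  /-- the resolution has finite length -/
  finite_length : ∃ q, ∀ i, q < i → rank i = 0
  /-- the augmentation is multihomogeneous of degree `0`: it maps `e_{0,j}` to an element of
  `S` of multidegree `a_{0j}` -/
  aug_homogeneous : ∀ j, ∃ c : K, aug j = monomial (shift 0 j) c
  /-- the differentials are multihomogeneous of degree `0`: the entry `p` in row `l` and column
  `j` has multidegree `a_{i+1,j} - a_{i,l}`, that is, `p * x^{a_{i,l}} ∈ K * x^{a_{i+1,j}}`
  (in particular `p = 0` if `a_{i+1,j} - a_{i,l}` has a negative entry) -/
  d_homogeneous : ∀ i l j, ∃ c : K,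
    d i l j * monomial (shift i l) (1 : K) = monomial (shift (i + 1) j) c
  /-- the augmentation maps onto `I` -/
  range_aug : LinearMap.range (Fintype.linearCombination (MvPolynomial (Fin n) K) aug) = I
  /-- exactness at `F_0` -/
  exact_zero : Function.Exact (d 0).mulVecLin
    (Fintype.linearCombination (MvPolynomial (Fin n) K) aug)
  /-- exactness at `F_{i+1}` -/
  exact_succ : ∀ i, Function.Exact (d (i + 1)).mulVecLin (d i).mulVecLin
  /-- minimality: the image of `F_{i+1}` is contained in `(x_1,…,x_n) F_i` -/
  minimal : ∀ i l j, d i l j ∈ Ideal.span (Set.range (X : Fin n → MvPolynomial (Fin n) K))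

/-- The `k`-th homological shift ideal of `I`: the ideal generated by the monomials `x^a`, where
`a` runs through the multigraded shifts of `F_k` in a minimal multigraded free resolution of `I`.
(Such a resolution exists for every monomial ideal and is unique up to isomorphism, so the shifts
do not depend on its choice.) -/
noncomputable def HS {K : Type*} [Field K] {n : ℕ} (k : ℕ) (I : Ideal (MvPolynomial (Fin n) K)) :
    Ideal (MvPolynomial (Fin n) K) :=
  Ideal.span {p | ∃ (F : MinimalMultigradedResolution I) (j : Fin (F.rank k)),
    p = monomial (F.shift k j) (1 : K)}

/-- The analytic spread of an ideal `I` of `S = K[x_1,…,x_n]`: the Krull dimension of the fiber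
ring `R(I) / 𝔪 R(I) = ⨁_k I^k / 𝔪 I^k`, where `R(I)` is the Rees algebra of `I` and
`𝔪 = (x_1,…,x_n)`. -/
noncomputable def analyticSpread {K : Type*} [Field K] {n : ℕ}
    (I : Ideal (MvPolynomial (Fin n) K)) : WithBot ℕ∞ :=
  ringKrullDim (reesAlgebra I ⧸
    (Ideal.span (Set.range (X : Fin n → MvPolynomial (Fin n) K))).map
      (algebraMap (MvPolynomial (Fin n) K) (reesAlgebra I)))

/-! Let `d` be the common degree of the generators and `B` the set of supports of squarefree
monomials in `I`. The shifts of `F_p` are exactly the squarefree vectors with support `A = u ∪ v`,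
where `u ∈ B` has `d` elements, `v` has `p` elements and is disjoint from `u`, and no element of `v`
exceeds the maximum of `u`. These are the sets in `shiftSets B d p`. They are found through
multigraded Koszul homology: `koszulExact_idealFamily_iff` identifies the shifts of any minimal
resolution with the multidegrees where this homology of `I` is nonzero, and the Borel property
decides when it vanishes (`exists_shift_eq_iff`).

Deleting an element of `v` shows `HS_{p+1}(I) ⊆ HS_p(I)`, which gives the inequality of heights.

For the analytic spread, both ideals are equigenerated, so their fiber rings are toric rings, whose
dimension is a transcendence degree. The family `shiftSets B d p` is again closed under Borel
exchange (`exchange_mem_shiftSets`). Hence a set `A` in homological degree `p + 1` can be moved to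
an initial segment by exchanges `j → i`, each contributing a factor `x_j / x_i`. Each such factor is
already a quotient of two generators of `HS_p(I)`, because `j` lies in a member of `shiftSets B d p`
contained in `A` (`prod_div_prod_mem`). After rescaling `T`, the generators of the toric ring of
`HS_{p+1}(I)` thus lie in the fraction field of that of `HS_p(I)`. -/

/-! ### Krull dimension and transcendence degree of affine domains. -/

/-- Incomparability bounds the dimension of `A` from above; lying over and going up lift chains from
`R`. -/
theorem ringKrullDim_eq_of_isIntegral {R A : Type*} [CommRing R] [CommRing A] [Algebra R A]
    [Algebra.IsIntegral R A] [FaithfulSMul R A] : ringKrullDim A = ringKrullDim R := by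
  apply le_antisymm
  · refine Order.krullDim_le_of_strictMono (PrimeSpectrum.comap (algebraMap R A)) ?_
    intro P Q h
    exact Ideal.IsIntegral.comap_lt_comap (R := R) (I := P.asIdeal) (J := Q.asIdeal) h
  · refine iSup_le fun l => ?_
    obtain ⟨⟨P, hP, hl⟩⟩ := (inferInstance :
      Nonempty ((RelSeries.head l).asIdeal.primesOver A))
    obtain ⟨L, hL, -⟩ := Ideal.exists_ltSeries_of_hasGoingUp l P
    rw [← hL]
    exact Order.LTSeries.length_le_krullDim L

/-- By Noether normalization, `A` is integral over a polynomial ring in `s` variables, which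
computes both invariants. -/
theorem exists_ringKrullDim_eq_trdeg (K A : Type*) [Field K] [CommRing A] [IsDomain A]
    [Algebra K A] [Algebra.FiniteType K A] :
    ∃ s : ℕ, ringKrullDim A = s ∧ Algebra.trdeg K A = s := by
  obtain ⟨s, g, hinj, hint⟩ := exists_integral_inj_algHom_of_fg K A
  refine ⟨s, ?_, ?_⟩
  · let _ : Algebra (MvPolynomial (Fin s) K) A := g.toRingHom.toAlgebra
    have : Algebra.IsIntegral (MvPolynomial (Fin s) K) A := ⟨hint⟩
    have : FaithfulSMul (MvPolynomial (Fin s) K) A :=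
      (faithfulSMul_iff_algebraMap_injective _ _).mpr hinj
    rw [ringKrullDim_eq_of_isIntegral (R := MvPolynomial (Fin s) K)]
    simp
  · let _ : Algebra (MvPolynomial (Fin s) K) A := g.toRingHom.toAlgebra
    have : Algebra.IsIntegral (MvPolynomial (Fin s) K) A := ⟨hint⟩
    have : FaithfulSMul (MvPolynomial (Fin s) K) A :=
      (faithfulSMul_iff_algebraMap_injective _ _).mpr hinj
    have : IsScalarTower K (MvPolynomial (Fin s) K) A := .of_algebraMap_eq' g.comp_algebraMap.symm
    have h := lift_trdeg_add_eq K (MvPolynomial (Fin s) K) A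
    rw [trdeg_eq_zero (R := MvPolynomial (Fin s) K)] at h
    simpa using h.symm

universe u v in
theorem ringKrullDim_le_of_trdeg_le {K : Type*} {A : Type u} {B : Type v} [Field K] [CommRing A] [IsDomain A]
    [Algebra K A] [Algebra.FiniteType K A] [CommRing B] [IsDomain B]
    [Algebra K B] [Algebra.FiniteType K B]
    (h : Cardinal.lift.{v} (Algebra.trdeg K A) ≤ Cardinal.lift.{u} (Algebra.trdeg K B)) :
    ringKrullDim A ≤ ringKrullDim B := by
  obtain ⟨s, hs, hs'⟩ := exists_ringKrullDim_eq_trdeg K A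
  obtain ⟨t, ht, ht'⟩ := exists_ringKrullDim_eq_trdeg K B
  rw [hs', ht'] at h
  rw [hs, ht]
  have : s ≤ t := by simpa using h
  exact_mod_cast this

/-- The field `K(G)` is algebraic over `K[G]`, so both have the same transcendence degree, and
`K[G']` embeds in `K(G)`. -/
theorem trdeg_adjoin_le_of_subset_adjoin {K L : Type*} [Field K] [Field L] [Algebra K L]
    {G G' : Set L} (h : G' ⊆ IntermediateField.adjoin K G) :
    Algebra.trdeg K (Algebra.adjoin K G') ≤ Algebra.trdeg K (Algebra.adjoin K G) := by
  open scoped IntermediateField.algebraAdjoinAdjoin in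
  have e := trdeg_add_eq K (Algebra.adjoin K G) (A := IntermediateField.adjoin K G)
  rw [trdeg_eq_zero (R := Algebra.adjoin K G), add_zero] at e
  rw [e]
  have hle : Algebra.adjoin K G' ≤ (IntermediateField.adjoin K G).toSubalgebra :=
    Algebra.adjoin_le h
  exact trdeg_le_of_injective (Subalgebra.inclusion hle) (Subalgebra.inclusion_injective hle)

/-- Krull dimensions of two affine subalgebras of a domain can be compared if, after suitable
embeddings, the generators of one are rational functions in those of the other. -/
theorem ringKrullDim_adjoin_le {K R L : Type*} [Field K] [CommRing R] [IsDomain R] [Algebra K R]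
    [Field L] [Algebra K L] {G G' : Set R} (hG : G.Finite) (hG' : G'.Finite)
    (f f' : R →ₐ[K] L) (hf : Function.Injective f) (hf' : Function.Injective f')
    (h : ∀ x ∈ G', f' x ∈ IntermediateField.adjoin K (f '' G)) :
    ringKrullDim (Algebra.adjoin K G') ≤ ringKrullDim (Algebra.adjoin K G) := by
  have key : ∀ (g : R →ₐ[K] L) (_ : Function.Injective g) {H : Set R}, H.Finite →
      ringKrullDim (Algebra.adjoin K H) = ringKrullDim (Algebra.adjoin K (g '' H)) ∧
      Algebra.FiniteType K (Algebra.adjoin K (g '' H)) := by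
    intro g hg H hH
    constructor
    · rw [← AlgHom.map_adjoin]
      exact ringKrullDim_eq_of_ringEquiv
        ((Algebra.adjoin K H).equivMapOfInjective g hg).toRingEquiv
    · rw [← Subalgebra.fg_iff_finiteType]
      exact ⟨(hH.image g).toFinset, by simp⟩
  rw [(key f' hf' hG').1, (key f hf hG).1]
  have := (key f' hf' hG').2
  have := (key f hf hG).2
  refine ringKrullDim_le_of_trdeg_le (K := K) ?_
  simpa using trdeg_adjoin_le_of_subset_adjoin (by rintro _ ⟨x, hx, rfl⟩; exact h x hx)

/-! ### Fiber rings of equigenerated monomial ideals. -/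

section FiberRing

variable {K : Type*} [Field K] {n : ℕ}

/-- The monomial ideal generated by the monomials with exponent vectors in `W`. -/
noncomputable abbrev monomialIdeal (K : Type*) [Field K] {n : ℕ} (W : Set (Fin n →₀ ℕ)) :
    Ideal (MvPolynomial (Fin n) K) :=
  Ideal.span ((fun u => (monomial u (1 : K) : MvPolynomial (Fin n) K)) '' W)

/-- The degree one generators `x^u T` of the Rees algebra of a monomial ideal. -/
noncomputable abbrev reesGenerators (K : Type*) [Field K] {n : ℕ} (W : Set (Fin n →₀ ℕ)) :
    Set (Polynomial (MvPolynomial (Fin n) K)) :=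
  (fun u => Polynomial.monomial 1 (monomial u (1 : K))) '' W

theorem reesAlgebra_monomialIdeal (W : Set (Fin n →₀ ℕ)) :
    reesAlgebra (monomialIdeal K W) =
      Algebra.adjoin (MvPolynomial (Fin n) K) (reesGenerators K W) := by
  rw [← adjoin_monomial_eq_reesAlgebra, monomialIdeal, Ideal.span, Submodule.map_span,
    Algebra.adjoin_span, Set.image_image]

theorem adjoin_reesGenerators_le (W : Set (Fin n →₀ ℕ)) :
    Algebra.adjoin K (reesGenerators K W) ≤
      (reesAlgebra (monomialIdeal K W)).restrictScalars K := by
  rw [reesAlgebra_monomialIdeal]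
  exact Algebra.adjoin_le Algebra.subset_adjoin

theorem monomialIdeal_le_pow {W : Set (Fin n →₀ ℕ)} {D : ℕ} (hW : ∀ w ∈ W, w.degree = D) :
    monomialIdeal K W ≤ idealOfVars (Fin n) K ^ D := by
  rw [monomialIdeal, Ideal.span_le]
  rintro _ ⟨w, hw, rfl⟩
  exact (monomial_mem_pow_idealOfVars_iff D w one_ne_zero).mpr (hW w hw).ge

theorem isHomogeneous_coeff_of_mem_adjoin {W : Set (Fin n →₀ ℕ)} {D : ℕ}
    (hW : ∀ w ∈ W, w.degree = D) {p : Polynomial (MvPolynomial (Fin n) K)}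
    (hp : p ∈ Algebra.adjoin K (reesGenerators K W)) (r : ℕ) :
    (p.coeff r).IsHomogeneous (D * r) := by
  induction hp using Algebra.adjoin_induction generalizing r with
  | mem x hx =>
    obtain ⟨w, hw, rfl⟩ := hx
    rw [Polynomial.coeff_monomial]
    split_ifs with h
    · subst h
      exact isHomogeneous_monomial _ (by rw [hW w hw, mul_one])
    · exact isHomogeneous_zero _ _ _
  | algebraMap c =>
    rw [Polynomial.algebraMap_apply, Polynomial.coeff_C]
    split_ifs with h
    · subst h
      exact isHomogeneous_C _ _
    · exact isHomogeneous_zero _ _ _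
  | add x y _ _ hx hy =>
    rw [Polynomial.coeff_add]
    exact (hx r).add (hy r)
  | mul x y _ _ hx hy =>
    rw [Polynomial.coeff_mul]
    refine IsHomogeneous.sum _ _ _ fun i hi => ?_
    rw [← Finset.HasAntidiagonal.mem_antidiagonal.mp hi, mul_add]
    exact (hx _).mul (hy _)

theorem coeff_mem_pow_of_mem_map {J : Ideal (MvPolynomial (Fin n) K)} {D : ℕ}
    (hJ : J ≤ idealOfVars (Fin n) K ^ D) {p : reesAlgebra J}
    (hp : p ∈ (idealOfVars (Fin n) K).map
      (algebraMap (MvPolynomial (Fin n) K) (reesAlgebra J))) (r : ℕ) :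
    (p : Polynomial (MvPolynomial (Fin n) K)).coeff r ∈ idealOfVars (Fin n) K ^ (D * r + 1) := by
  induction hp using Submodule.span_induction generalizing r with
  | mem x hx =>
    obtain ⟨f, hf, rfl⟩ := hx
    change (Polynomial.C f).coeff r ∈ _
    rw [Polynomial.coeff_C]
    split_ifs with h
    · subst h
      simpa using hf
    · exact zero_mem _
  | zero => exact zero_mem _
  | add x y _ _ hx hy => exact add_mem (hx r) (hy r)
  | smul a x _ hx =>
    change ((a : Polynomial (MvPolynomial (Fin n) K)) * x).coeff r ∈ _
    rw [Polynomial.coeff_mul]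
    refine sum_mem fun i hi => ?_
    rw [← Finset.HasAntidiagonal.mem_antidiagonal.mp hi, mul_add, add_assoc, pow_add, pow_mul]
    exact Ideal.mul_mem_mul (Ideal.pow_right_mono hJ _ (a.2 _)) (hx _)

/-- The fiber ring of an ideal generated by monomials of the same degree is the toric ring
generated by these monomials. -/
theorem analyticSpread_monomialIdeal {W : Set (Fin n →₀ ℕ)} {D : ℕ}
    (hW : ∀ w ∈ W, w.degree = D) :
    analyticSpread (monomialIdeal K W) =
      ringKrullDim (Algebra.adjoin K (reesGenerators K W)) := by
  set J := monomialIdeal K W with hJ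
  set Q := (idealOfVars (Fin n) K).map (algebraMap (MvPolynomial (Fin n) K) (reesAlgebra J))
  let φ : Algebra.adjoin K (reesGenerators K W) →ₐ[K] reesAlgebra J ⧸ Q :=
    (Ideal.Quotient.mkₐ K Q).comp (Subalgebra.inclusion (adjoin_reesGenerators_le W))
  suffices h : Function.Bijective φ from
    (ringKrullDim_eq_of_ringEquiv (AlgEquiv.ofBijective φ h).toRingEquiv).symm
  constructor
  -- A kernel element has `T^r`-coefficient homogeneous of degree `D * r`, yet lying in the power `D
  -- * r + 1` of the ideal of the variables; so it vanishes.
  · rw [injective_iff_map_eq_zero]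
    rintro ⟨p, hp⟩ h
    rw [Subtype.ext_iff]
    ext1 r
    have h1 := isHomogeneous_coeff_of_mem_adjoin hW hp r
    have h2 := coeff_mem_pow_of_mem_map (monomialIdeal_le_pow hW)
      (Ideal.Quotient.eq_zero_iff_mem.mp h) r
    change p.coeff r ∈ _ at h2
    rw [mem_pow_idealOfVars_iff'] at h2
    change p.coeff r = 0
    ext e
    by_contra hne
    have := not_imp_comm.mp (h1.coeff_eq_zero (d := e)) hne
    exact hne (h2 e (by lia))
  · intro y
    obtain ⟨⟨p, hp⟩, rfl⟩ := Ideal.Quotient.mk_surjective y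
    have hp' := hp
    rw [reesAlgebra_monomialIdeal] at hp'
    suffices h : ∀ hp : p ∈ reesAlgebra J, Ideal.Quotient.mk Q ⟨p, hp⟩ ∈ φ.range from h hp
    have hle : Algebra.adjoin (MvPolynomial (Fin n) K) (reesGenerators K W) ≤ reesAlgebra J :=
      (reesAlgebra_monomialIdeal W).ge
    induction hp' using Algebra.adjoin_induction with
    | mem x hx => exact fun h => ⟨⟨x, Algebra.subset_adjoin hx⟩, rfl⟩
    | algebraMap f =>
      intro h
      refine ⟨⟨_, Subalgebra.algebraMap_mem _ (constantCoeff f)⟩, ?_⟩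
      refine (Ideal.Quotient.eq (I := Q)).mpr ?_
      -- Modulo the ideal of the variables a coefficient equals its constant term, so scalars from
      -- `K` suffice.
      have : C (constantCoeff f) - f ∈ idealOfVars (Fin n) K := by
        rw [← pow_one (idealOfVars (Fin n) K), mem_pow_idealOfVars_iff']
        intro x hx
        have : x = 0 := (Finsupp.degree_eq_zero_iff x).mp (Nat.lt_one_iff.mp hx)
        subst this
        simp [constantCoeff_eq]
      convert! Ideal.mem_map_of_mem (algebraMap (MvPolynomial (Fin n) K) (reesAlgebra J)) this
      rw [map_sub]
      rfl
    | add x y hx hy hx' hy' =>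
      intro h
      exact add_mem (hx' (hle hx) (hle hx)) (hy' (hle hy) (hle hy))
    | mul x y hx hy hx' hy' =>
      intro h
      exact mul_mem (hx' (hle hx) (hle hx)) (hy' (hle hy) (hle hy))

end FiberRing

/-! ### The Koszul differential and its contracting homotopies. -/

section Koszul

variable {n : ℕ} {M M' : Type*} [AddCommGroup M] [AddCommGroup M']

/-- The sign of `k` in the Koszul complex, relative to the set `σ`. -/
def koszulSign (k : Fin n) (σ : Finset (Fin n)) : ℤ :=
  ∏ l ∈ σ, if l < k then -1 else 1

theorem koszulSign_mul_self (k : Fin n) (σ : Finset (Fin n)) :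
    koszulSign k σ * koszulSign k σ = 1 := by
  rw [koszulSign, ← Finset.prod_mul_distrib]
  exact Finset.prod_eq_one fun l _ => by split_ifs <;> rfl

theorem koszulSign_insert {k l : Fin n} {σ : Finset (Fin n)} (h : l ∉ σ) :
    koszulSign k (insert l σ) = (if l < k then -1 else 1) * koszulSign k σ :=
  Finset.prod_insert h

/-- The Koszul differential on functions on the finite subsets of the variables. -/
def koszulD (f : Finset (Fin n) → M) (τ : Finset (Fin n)) : M :=
  ∑ j ∈ τᶜ, koszulSign j τ • f (insert j τ)

theorem koszulD_sub (f g : Finset (Fin n) → M) : koszulD (f - g) = koszulD f - koszulD g := by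
  ext τ
  simp [koszulD, smul_sub]

theorem koszulD_comp (φ : M →+ M') (f : Finset (Fin n) → M) :
    koszulD (fun σ => φ (f σ)) = fun σ => φ (koszulD f σ) := by
  ext τ
  simp [koszulD]

theorem koszulD_koszulD (f : Finset (Fin n) → M) : koszulD (koszulD f) = 0 := by
  ext τ
  simp only [koszulD, Finset.smul_sum, Pi.zero_apply, smul_smul]
  rw [Finset.sum_sigma']
  -- Adding `j` then `l` and adding `l` then `j` reach the same set with opposite signs.
  refine Finset.sum_involution (fun p _ => ⟨p.2, p.1⟩) ?_ ?_ ?_ ?_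
  · rintro ⟨j, l⟩ h
    simp only [Finset.mem_sigma, Finset.mem_compl, Finset.mem_insert, not_or] at h
    obtain ⟨hj, hlj, hl⟩ := h
    dsimp only
    rw [koszulSign_insert hj, koszulSign_insert hl, Finset.insert_comm, ← add_smul]
    rcases lt_or_gt_of_ne hlj with h | h
    · rw [if_neg h.not_gt, if_pos h]
      convert! zero_smul ℤ _
      ring
    · rw [if_pos h, if_neg h.not_gt]
      convert! zero_smul ℤ _
      ring
  · rintro ⟨j, l⟩ h _ he
    simp only [Finset.mem_sigma, Finset.mem_compl, Finset.mem_insert, not_or] at h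
    simp only [Sigma.mk.injEq, heq_eq_eq] at he
    exact h.2.1 he.1
  · rintro ⟨j, l⟩ h
    simp only [Finset.mem_sigma, Finset.mem_compl, Finset.mem_insert, not_or] at h ⊢
    exact ⟨h.2.2, Ne.symm h.2.1, h.1⟩
  · rintro ⟨j, l⟩ _
    rfl

/-- The contracting homotopy of the Koszul complex given by the variable `k`. -/
def koszulH (k : Fin n) (f : Finset (Fin n) → M) (σ : Finset (Fin n)) : M :=
  if k ∈ σ then koszulSign k (σ.erase k) • f (σ.erase k) else 0

theorem koszulH_insert {k : Fin n} (f : Finset (Fin n) → M) {σ : Finset (Fin n)} (h : k ∉ σ) :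
    koszulH k f (insert k σ) = koszulSign k σ • f σ := by
  simp [koszulH, Finset.erase_insert h]

theorem koszulH_of_notMem {k : Fin n} (f : Finset (Fin n) → M) {σ : Finset (Fin n)} (h : k ∉ σ) :
    koszulH k f σ = 0 := if_neg h

theorem koszulD_koszulH_add (k : Fin n) (f : Finset (Fin n) → M) :
    koszulD (koszulH k f) + koszulH k (koszulD f) = f := by
  ext τ
  rw [Pi.add_apply]
  by_cases hk : k ∈ τ
  · obtain ⟨ρ, hρ, rfl⟩ : ∃ ρ, k ∉ ρ ∧ insert k ρ = τ :=
      ⟨τ.erase k, Finset.notMem_erase k τ, Finset.insert_erase hk⟩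
    rw [koszulH_insert _ hρ]
    have hc : ρᶜ = insert k (insert k ρ)ᶜ := by
      ext l
      by_cases h : l = k <;> simp [h, hρ]
    have e : koszulD f ρ = koszulSign k ρ • f (insert k ρ) +
        ∑ j ∈ (insert k ρ)ᶜ, koszulSign j ρ • f (insert j ρ) := by
      rw [koszulD, hc, Finset.sum_insert (by simp)]
    rw [e, smul_add, smul_smul, koszulSign_mul_self, one_smul, koszulD, add_left_comm,
      add_eq_left, Finset.smul_sum, ← Finset.sum_add_distrib]
    refine Finset.sum_eq_zero fun j hj => ?_
    simp only [Finset.mem_compl, Finset.mem_insert, not_or] at hj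
    rw [Finset.insert_comm, koszulH_insert _ (by simp [Ne.symm hj.1, hρ]), koszulSign_insert hρ,
      koszulSign_insert hj.2, smul_smul, smul_smul, ← add_smul]
    rcases lt_or_gt_of_ne hj.1 with h | h
    · rw [if_neg h.not_gt, if_pos h]
      convert! zero_smul ℤ _
      ring
    · rw [if_pos h, if_neg h.not_gt]
      convert! zero_smul ℤ _
      ring
  · rw [koszulH_of_notMem _ hk, add_zero, koszulD,
      Finset.sum_eq_single_of_mem k (by simpa using hk), koszulH_insert _ hk, smul_smul,
      koszulSign_mul_self, one_smul]
    intro j hj hjk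
    rw [koszulH_of_notMem _ (by simp [Ne.symm hjk, hk]), smul_zero]

theorem koszulD_koszulH (k : Fin n) {f : Finset (Fin n) → M} (hf : koszulD f = 0) :
    koszulD (koszulH k f) = f := by
  have h := koszulD_koszulH_add k f
  rw [hf] at h
  have : koszulH k (0 : Finset (Fin n) → M) = 0 := by ext; simp [koszulH]
  rwa [this, add_zero] at h

end Koszul

/-! ### Koszul homology of families of subspaces and dimension shifting. -/

section KoszulFamily

variable {K : Type*} [Field K] {n : ℕ} {M M' : Type*} [AddCommGroup M] [AddCommGroup M']
  [Module K M] [Module K M']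

/-- The `p`-chains of the Koszul complex of a family of subspaces. -/
def IsKoszulChain (V : Finset (Fin n) → Submodule K M) (p : ℕ) (f : Finset (Fin n) → M) : Prop :=
  ∀ σ, f σ ∈ V σ ∧ (σ.card ≠ p → f σ = 0)

/-- The Koszul complex of a family of subspaces has no homology in degree `p`. -/
def KoszulExact (V : Finset (Fin n) → Submodule K M) (p : ℕ) : Prop :=
  ∀ f, IsKoszulChain V p f → koszulD f = 0 → ∃ g, IsKoszulChain V (p + 1) g ∧ koszulD g = f

theorem IsKoszulChain.mono {V W : Finset (Fin n) → Submodule K M} {p : ℕ}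
    {f : Finset (Fin n) → M} (hf : IsKoszulChain V p f) (h : ∀ σ, V σ ≤ W σ) :
    IsKoszulChain W p f := fun σ => ⟨h σ (hf σ).1, (hf σ).2⟩

theorem IsKoszulChain.sub {V : Finset (Fin n) → Submodule K M} {p : ℕ}
    {f g : Finset (Fin n) → M} (hf : IsKoszulChain V p f) (hg : IsKoszulChain V p g) :
    IsKoszulChain V p (f - g) := fun σ =>
  ⟨sub_mem (hf σ).1 (hg σ).1, fun h => by simp [(hf σ).2 h, (hg σ).2 h]⟩

theorem IsKoszulChain.koszulD {V : Finset (Fin n) → Submodule K M} (hV : Antitone V) {p : ℕ}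
    {f : Finset (Fin n) → M} (hf : IsKoszulChain V (p + 1) f) :
    IsKoszulChain V p (koszulD f) := fun τ => by
  constructor
  · exact sum_mem fun j _ => zsmul_mem (hV (Finset.subset_insert j τ) (hf _).1) _
  · intro h
    refine Finset.sum_eq_zero fun j hj => ?_
    rw [(hf _).2, smul_zero]
    rw [Finset.card_insert_of_notMem (by simpa using hj)]
    lia

theorem IsKoszulChain.koszulD_zero {V : Finset (Fin n) → Submodule K M}
    {f : Finset (Fin n) → M} (hf : IsKoszulChain V 0 f) : _root_.koszulD f = 0 := by
  ext τ
  refine Finset.sum_eq_zero fun j _ => ?_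
  rw [(hf _).2 (by simp), smul_zero]

theorem IsKoszulChain.map {V : Finset (Fin n) → Submodule K M} {p : ℕ}
    {f : Finset (Fin n) → M} (hf : IsKoszulChain V p f) (D : M →ₗ[K] M') :
    IsKoszulChain (fun σ => (V σ).map D) p (fun σ => D (f σ)) := fun σ =>
  ⟨Submodule.mem_map_of_mem (hf σ).1, fun h => by simp [(hf σ).2 h]⟩

theorem IsKoszulChain.exists_lift {V : Finset (Fin n) → Submodule K M} {p : ℕ} {D : M →ₗ[K] M'}
    {f : Finset (Fin n) → M'} (hf : IsKoszulChain (fun σ => (V σ).map D) p f) :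
    ∃ g, IsKoszulChain V p g ∧ (fun σ => D (g σ)) = f := by
  choose g hg hgf using fun σ => (hf σ).1
  refine ⟨fun σ => if σ.card = p then g σ else 0, fun σ => ⟨?_, fun h => if_neg h⟩, ?_⟩
  · dsimp only
    split_ifs
    exacts [hg σ, zero_mem _]
  · ext σ
    dsimp only
    split_ifs with h
    · exact hgf σ
    · rw [map_zero, (hf σ).2 h]

/-- Dimension shifting: along a short exact sequence `0 → Z → V → D(V) → 0` of families of
subspaces the Koszul homology of `D(V)` in degree `p + 1` is that of `Z` in degree `p`. -/
theorem koszulExact_map_iff {V : Finset (Fin n) → Submodule K M} (hV : Antitone V)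
    (D : M →ₗ[K] M') {p : ℕ}
    (hZ : ∀ f, IsKoszulChain (fun σ => V σ ⊓ LinearMap.ker D) p f → koszulD f = 0 →
      ∃ g, IsKoszulChain V (p + 1) g ∧ koszulD g = f)
    (hV' : KoszulExact V (p + 1)) :
    KoszulExact (fun σ => (V σ).map D) (p + 1) ↔
      KoszulExact (fun σ => V σ ⊓ LinearMap.ker D) p := by
  have comp : ∀ f : Finset (Fin n) → M,
      koszulD (fun σ => D (f σ)) = fun σ => D (koszulD f σ) := koszulD_comp D.toAddMonoidHom
  -- In the long exact sequence, `hV'` makes the connecting map from degree `p + 1` to degree `p`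
  -- injective, and `hZ` makes it surjective. The two directions chase these facts by hand.
  constructor
  · intro h f hf hf0
    obtain ⟨c, hc, rfl⟩ := hZ f hf hf0
    obtain ⟨y, hy, hyc⟩ := h _ (hc.map D) (by
      rw [comp]
      ext σ
      exact (hf σ).1.2)
    obtain ⟨e, he, rfl⟩ := hy.exists_lift
    refine ⟨c - koszulD e, fun σ => ⟨⟨((hc.sub (he.koszulD hV)) σ).1, ?_⟩,
      ((hc.sub (he.koszulD hV)) σ).2⟩, ?_⟩
    · rw [comp] at hyc
      have := congrFun hyc σ
      change D (c σ - koszulD e σ) = 0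
      rw [map_sub, sub_eq_zero, ← this]
    · rw [koszulD_sub, koszulD_koszulD, sub_zero]
  · intro h z hz hz0
    obtain ⟨c, hc, rfl⟩ := hz.exists_lift
    rw [comp] at hz0
    obtain ⟨y, hy, hyc⟩ := h (koszulD c)
      (fun σ => ⟨⟨(hc.koszulD hV σ).1, congrFun hz0 σ⟩, (hc.koszulD hV σ).2⟩) (koszulD_koszulD c)
    have hy' : IsKoszulChain V (p + 1) y := hy.mono fun σ => inf_le_left
    obtain ⟨e, he, hec⟩ := hV' _ (hc.sub hy') (by rw [koszulD_sub, hyc, sub_self])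
    refine ⟨_, he.map D, ?_⟩
    rw [comp, hec]
    ext σ
    have : D (y σ) = 0 := (hy σ).1.2
    simp [this]

end KoszulFamily

/-! ### Cones, and the Koszul homology of multigraded free modules. -/

section Scalar

variable {K : Type*} [Field K] {n : ℕ}

/-- A cone has no Koszul homology: if the support of a cycle can be enlarged by `k`, the cycle is a
boundary. -/
theorem exists_koszulD_eq_of_insert {P : Finset (Fin n) → Prop} {p : ℕ} (k : Fin n)
    {f : Finset (Fin n) → K} (hf0 : koszulD f = 0) (hcard : ∀ σ, f σ ≠ 0 → σ.card = p)
    (hP : ∀ σ, k ∉ σ → f σ ≠ 0 → P (insert k σ)) :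
    ∃ g : Finset (Fin n) → K, (∀ σ, g σ ≠ 0 → P σ ∧ σ.card = p + 1) ∧ koszulD g = f := by
  refine ⟨koszulH k f, fun σ hσ => ?_, koszulD_koszulH k hf0⟩
  have hk : k ∈ σ := by
    by_contra h
    exact hσ (koszulH_of_notMem f h)
  rw [koszulH, if_pos hk] at hσ
  have hne : f (σ.erase k) ≠ 0 := fun h => hσ (by rw [h, smul_zero])
  have h1 := hP _ (Finset.notMem_erase k σ) hne
  rw [Finset.insert_erase hk] at h1
  refine ⟨h1, ?_⟩
  rw [← hcard _ hne, Finset.card_erase_add_one hk]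

end Scalar

section ShiftFamily

variable {K : Type*} [Field K] {n r : ℕ} {M : Type*} [AddCommGroup M] [Module K M]

/-- The family of subspaces of `K^r` attached to basis elements of multidegrees `s j` and a
multidegree `a`: its member at `σ` is spanned by the `e_j` such that `x^{s j}` divides
`x^a / x_σ`. -/
def shiftFamily (K : Type*) [Field K] {n r : ℕ} (s : Fin r → (Fin n →₀ ℕ)) (a : Fin n →₀ ℕ)
    (σ : Finset (Fin n)) : Submodule K (Fin r → K) where
  carrier := {v | ∀ j, v j ≠ 0 → s j ≤ a ∧ ∀ k ∈ σ, s j k < a k}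
  zero_mem' := fun j h => (h rfl).elim
  add_mem' := fun {v w} hv hw j h => by
    by_cases hj : v j = 0
    · exact hw j fun h' => h (by simp [hj, h'])
    · exact hv j hj
  smul_mem' := fun c v hv j h => hv j fun h' => h (by simp [h'])

theorem shiftFamily_antitone (s : Fin r → (Fin n →₀ ℕ)) (a : Fin n →₀ ℕ) :
    Antitone (shiftFamily K s a) := fun _ _ h _ hv j hj =>
  ⟨(hv j hj).1, fun k hk => (hv j hj).2 k (h hk)⟩

/-- The coordinates separate. For `s j ≤ a` with `s j ≠ a`, the admissible `σ` form a full simplex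
on the nonempty set of `k` with `s j k < a k`, hence a cone. -/
theorem exists_koszulD_eq_of_shift_ne {s : Fin r → (Fin n →₀ ℕ)} {a : Fin n →₀ ℕ} {p : ℕ}
    {f : Finset (Fin n) → Fin r → K} (hf : IsKoszulChain (shiftFamily K s a) p f)
    (hf0 : koszulD f = 0) (hne : ∀ σ j, f σ j ≠ 0 → s j ≠ a) :
    ∃ g, IsKoszulChain (shiftFamily K s a) (p + 1) g ∧ koszulD g = f := by
  have comp : ∀ (g : Finset (Fin n) → Fin r → K) (j : Fin r),
      koszulD (fun σ => g σ j) = fun σ => koszulD g σ j := fun g j =>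
    koszulD_comp (Pi.evalAddMonoidHom (fun _ : Fin r => K) j) g
  have key : ∀ j : Fin r, ∃ g : Finset (Fin n) → K,
      (∀ σ, g σ ≠ 0 → (s j ≤ a ∧ ∀ k ∈ σ, s j k < a k) ∧ σ.card = p + 1) ∧
        koszulD g = fun σ => f σ j := by
    intro j
    by_cases hj : ∃ k, s j k < a k
    · obtain ⟨k, hk⟩ := hj
      refine exists_koszulD_eq_of_insert k ?_ ?_ ?_
      · rw [comp, hf0]
        rfl
      · intro σ hσ
        by_contra h
        exact hσ (by rw [(hf σ).2 h]; rfl)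
      · intro σ _ hσ
        refine ⟨((hf σ).1 j hσ).1, fun l hl => ?_⟩
        rcases Finset.mem_insert.mp hl with rfl | hl
        exacts [hk, ((hf σ).1 j hσ).2 l hl]
    · refine ⟨0, fun σ h => (h rfl).elim, ?_⟩
      ext σ
      by_contra h
      have h' : f σ j ≠ 0 := by simpa [koszulD] using Ne.symm h
      push Not at hj
      exact hne σ j h' (le_antisymm ((hf σ).1 j h').1 hj)
  choose g hg hgf using key
  refine ⟨fun σ j => g j σ, fun σ => ⟨fun j hj => (hg j σ hj).1, fun h => ?_⟩, ?_⟩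
  · ext j
    by_contra hj
    exact h (hg j σ hj).2
  · ext σ j
    rw [← congrFun (hgf j) σ, ← congrFun (comp _ j) σ]

theorem koszulExact_shiftFamily (s : Fin r → (Fin n →₀ ℕ)) (a : Fin n →₀ ℕ) (p : ℕ) :
    KoszulExact (shiftFamily K s a) (p + 1) := by
  intro f hf hf0
  refine exists_koszulD_eq_of_shift_ne hf hf0 fun σ j hj => ?_
  have hσ : σ.card = p + 1 := by
    by_contra h
    exact hj (by rw [(hf σ).2 h]; rfl)
  obtain ⟨k, hk⟩ : σ.Nonempty := Finset.card_pos.mp (by lia)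
  rintro rfl
  exact lt_irrefl _ (((hf σ).1 j hj).2 k hk)

/-- The hypothesis `hD` is the form in which minimality enters: kernel vectors avoid the basis
elements of multidegree exactly `a`, the only ones carrying homology. -/
theorem koszulExact_map_shiftFamily_succ_iff {s : Fin r → (Fin n →₀ ℕ)} {a : Fin n →₀ ℕ}
    (D : (Fin r → K) →ₗ[K] M)
    (hD : ∀ v ∈ shiftFamily K s a ∅, D v = 0 → ∀ j, v j ≠ 0 → s j ≠ a) (p : ℕ) :
    KoszulExact (fun σ => (shiftFamily K s a σ).map D) (p + 1) ↔
      KoszulExact (fun σ => shiftFamily K s a σ ⊓ LinearMap.ker D) p := by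
  refine koszulExact_map_iff (shiftFamily_antitone s a) D (fun f hf hf0 => ?_)
    (koszulExact_shiftFamily s a p)
  refine exists_koszulD_eq_of_shift_ne (hf.mono fun σ => inf_le_left) hf0 fun σ j hj => ?_
  exact hD _ (shiftFamily_antitone s a (Finset.empty_subset σ) (hf σ).1.1) (hf σ).1.2 j hj

theorem koszulExact_map_shiftFamily_zero_iff {s : Fin r → (Fin n →₀ ℕ)} {a : Fin n →₀ ℕ}
    (D : (Fin r → K) →ₗ[K] M)
    (hD : ∀ v ∈ shiftFamily K s a ∅, D v = 0 → ∀ j, v j ≠ 0 → s j ≠ a) :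
    KoszulExact (fun σ => (shiftFamily K s a σ).map D) 0 ↔ ∀ j, s j ≠ a := by
  have comp : ∀ f : Finset (Fin n) → Fin r → K,
      koszulD (fun σ => D (f σ)) = fun σ => D (koszulD f σ) := koszulD_comp D.toAddMonoidHom
  constructor
  · rintro h j rfl
    have hv : IsKoszulChain (shiftFamily K s (s j)) 0
        (fun σ => if σ = ∅ then Pi.single j (1 : K) else 0) := fun σ => by
      constructor
      · intro l hl
        dsimp only at hl
        split_ifs at hl with hσ
        · subst hσ
          obtain rfl : l = j := by
            by_contra hlj
            exact hl (Pi.single_eq_of_ne hlj _)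
          exact ⟨le_rfl, by simp⟩
        · exact (hl rfl).elim
      · intro hσ
        exact if_neg fun h => hσ (by simp [h])
    obtain ⟨y, hy, hyv⟩ := h _ (hv.map D) (hv.map D).koszulD_zero
    obtain ⟨c, hc, rfl⟩ := hy.exists_lift
    rw [comp] at hyv
    -- A boundary at `∅` uses only basis elements whose shift is smaller than `s j` in some
    -- variable, so subtracting it leaves coordinate `j` equal to `1`. The difference is a kernel
    -- vector forbidden by `hD`.
    have h0 : koszulD c ∅ j = 0 := by
      rw [koszulD, Finset.sum_apply]
      refine Finset.sum_eq_zero fun k _ => ?_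
      by_contra hk
      have hk' : c (insert k ∅) j ≠ 0 := fun h => hk (by rw [Pi.smul_apply, h, smul_zero])
      exact lt_irrefl _ (((hc _).1 j hk').2 k (by simp))
    refine hD _ (sub_mem (hv ∅).1 (hc.koszulD (shiftFamily_antitone s (s j)) ∅).1) ?_ j ?_ rfl
    · rw [map_sub, sub_eq_zero]
      exact (congrFun hyv ∅).symm
    · simp [h0]
  · intro h f hf _
    obtain ⟨c, hc, rfl⟩ := hf.exists_lift
    obtain ⟨e, he, hec⟩ := exists_koszulD_eq_of_shift_ne hc hc.koszulD_zero fun σ j _ => h j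
    exact ⟨_, he.map D, by rw [comp, hec]⟩

/-- The squarefree exponent vector with support `σ`. -/
noncomputable def sqfreeExponent (σ : Finset (Fin n)) : Fin n →₀ ℕ :=
  Finsupp.equivFunOnFinite.symm fun i => if i ∈ σ then 1 else 0

@[simp]
theorem sqfreeExponent_apply (σ : Finset (Fin n)) (i : Fin n) :
    sqfreeExponent σ i = if i ∈ σ then 1 else 0 := rfl

/-- Positivity of `a` on `σ` keeps the subtraction from truncating; without it the family member is
zero by `shiftFamily_eq_bot`. -/
theorem mem_shiftFamily_iff {s : Fin r → (Fin n →₀ ℕ)} {a : Fin n →₀ ℕ} {σ : Finset (Fin n)}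
    (hσ : ∀ k ∈ σ, 0 < a k) {v : Fin r → K} :
    v ∈ shiftFamily K s a σ ↔ ∀ j, v j ≠ 0 → s j ≤ a - sqfreeExponent σ := by
  refine forall₂_congr fun j _ => ?_
  constructor
  · intro h k
    have h1 := h.1 k
    have h2 := h.2 k
    rw [Finsupp.tsub_apply, sqfreeExponent_apply]
    split_ifs with hk
    · have := h2 hk
      lia
    · exact h1
  · intro h
    refine ⟨h.trans tsub_le_self, fun k hk => ?_⟩
    have h1 := h k
    have h2 := hσ k hk
    rw [Finsupp.tsub_apply, sqfreeExponent_apply, if_pos hk] at h1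
    lia

theorem shiftFamily_eq_bot {s : Fin r → (Fin n →₀ ℕ)} {a : Fin n →₀ ℕ} {σ : Finset (Fin n)}
    (hσ : ¬ ∀ k ∈ σ, 0 < a k) : shiftFamily K s a σ = ⊥ := by
  rw [eq_bot_iff]
  intro v hv
  push Not at hσ
  obtain ⟨k, hk, h⟩ := hσ
  ext j
  by_contra hj
  have := (hv j hj).2 k hk
  lia

/-- The subspaces `I_{a - σ}` of `K`, for a monomial ideal `I` and a multidegree `a`. -/
def idealFamily (I : Ideal (MvPolynomial (Fin n) K)) (a : Fin n →₀ ℕ) (σ : Finset (Fin n)) :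
    Submodule K K where
  carrier := {c | c ≠ 0 → (∀ k ∈ σ, 0 < a k) ∧ monomial (a - sqfreeExponent σ) (1 : K) ∈ I}
  zero_mem' := fun h => (h rfl).elim
  add_mem' := fun {v w} hv hw h => by
    by_cases hj : v = 0
    · exact hw fun h' => h (by simp [hj, h'])
    · exact hv hj
  smul_mem' := fun c v hv h => hv fun h' => h (by simp [h'])

end ShiftFamily

/-! ### Multigraded strands of a minimal resolution, and its shifts as Koszul homology. -/

namespace MinimalMultigradedResolution

variable {K : Type*} [Field K] {n : ℕ} {I : Ideal (MvPolynomial (Fin n) K)}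
  (F : MinimalMultigradedResolution I)

/-- The scalar coefficients of the entries of the differential `F_{i+1} → F_i`. -/
noncomputable def dCoeff (i : ℕ) : Matrix (Fin (F.rank i)) (Fin (F.rank (i + 1))) K :=
  fun l j => (F.d_homogeneous i l j).choose

/-- The scalar coefficients of the augmentation. -/
noncomputable def augCoeff (j : Fin (F.rank 0)) : K := (F.aug_homogeneous j).choose

theorem d_mul_monomial (i : ℕ) (l : Fin (F.rank i)) (j : Fin (F.rank (i + 1))) :
    F.d i l j * monomial (F.shift i l) (1 : K) = monomial (F.shift (i + 1) j) (F.dCoeff i l j) :=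
  (F.d_homogeneous i l j).choose_spec

theorem aug_eq_monomial (j : Fin (F.rank 0)) :
    F.aug j = monomial (F.shift 0 j) (F.augCoeff j) :=
  (F.aug_homogeneous j).choose_spec

/-- The differential `F_{i+1} → F_i` after setting all variables to `1`. -/
noncomputable def dLin (i : ℕ) : (Fin (F.rank (i + 1)) → K) →ₗ[K] (Fin (F.rank i) → K) :=
  (F.dCoeff i).mulVecLin

/-- The augmentation after setting all variables to `1`. -/
noncomputable def augLin : (Fin (F.rank 0) → K) →ₗ[K] K :=
  Fintype.linearCombination K F.augCoeff

/-- The component of multidegree `b` of an element of `F_i`. -/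
noncomputable def strand (i : ℕ) (b : Fin n →₀ ℕ) (w : Fin (F.rank i) → MvPolynomial (Fin n) K) :
    Fin (F.rank i) → K := fun j => coeff b (w j * monomial (F.shift i j) 1)

/-- The element of `F_i` of multidegree `b` with given coefficients. -/
noncomputable def homogenize (i : ℕ) (b : Fin n →₀ ℕ) (v : Fin (F.rank i) → K) :
    Fin (F.rank i) → MvPolynomial (Fin n) K := fun j => monomial (b - F.shift i j) (v j)

variable {F} {i : ℕ} {b : Fin n →₀ ℕ}

theorem dLin_apply (v : Fin (F.rank (i + 1)) → K) (l : Fin (F.rank i)) :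
    F.dLin i v l = ∑ j, F.dCoeff i l j * v j := rfl

theorem augLin_apply (v : Fin (F.rank 0) → K) :
    F.augLin v = ∑ j, v j * F.augCoeff j := rfl

theorem shift_le_of_strand_ne_zero {w : Fin (F.rank i) → MvPolynomial (Fin n) K}
    {j : Fin (F.rank i)} (h : F.strand i b w j ≠ 0) : F.shift i j ≤ b := by
  by_contra hj
  exact h (by rw [strand, coeff_mul_monomial', if_neg hj])

theorem strand_homogenize {v : Fin (F.rank i) → K} (hv : ∀ j, v j ≠ 0 → F.shift i j ≤ b) :
    F.strand i b (F.homogenize i b v) = v := by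
  ext j
  rw [strand, homogenize, monomial_mul, mul_one, coeff_monomial]
  by_cases h : v j = 0
  · simp [h]
  · rw [if_pos (tsub_add_cancel_of_le (hv j h))]

theorem strand_mulVec (w : Fin (F.rank (i + 1)) → MvPolynomial (Fin n) K) :
    F.strand i b ((F.d i).mulVec w) = F.dLin i (F.strand (i + 1) b w) := by
  ext l
  rw [strand, dLin_apply, Matrix.mulVec, dotProduct, Finset.sum_mul, coeff_sum]
  refine Finset.sum_congr rfl fun j _ => ?_
  have h := F.d_mul_monomial i l j
  rw [mul_right_comm, h, strand, ← coeff_C_mul, ← mul_assoc, mul_right_comm, C_mul_monomial,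
    mul_one, mul_comm]

theorem coeff_linearCombination_aug (w : Fin (F.rank 0) → MvPolynomial (Fin n) K) :
    coeff b (Fintype.linearCombination (MvPolynomial (Fin n) K) F.aug w) =
      F.augLin (F.strand 0 b w) := by
  rw [Fintype.linearCombination_apply, coeff_sum, augLin_apply]
  refine Finset.sum_congr rfl fun j _ => ?_
  have h := F.aug_eq_monomial j
  rw [smul_eq_mul, h, strand, mul_comm (coeff _ _), ← coeff_C_mul, mul_left_comm, C_mul_monomial,
    mul_one]

theorem mulVec_homogenize {v : Fin (F.rank (i + 1)) → K}
    (hv : ∀ j, v j ≠ 0 → F.shift (i + 1) j ≤ b) (h0 : F.dLin i v = 0) :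
    (F.d i).mulVec (F.homogenize (i + 1) b v) = 0 := by
  ext1 l
  have hl : (monomial (F.shift i l) (1 : K)) ≠ 0 := by simp
  refine (mul_eq_zero_iff_right hl).mp ?_
  rw [Matrix.mulVec, dotProduct, Finset.sum_mul]
  have : ∀ j, F.d i l j * F.homogenize (i + 1) b v j * monomial (F.shift i l) (1 : K) =
      monomial b (F.dCoeff i l j * v j) := by
    intro j
    rw [mul_right_comm, F.d_mul_monomial i l j, homogenize, monomial_mul]
    by_cases h : v j = 0
    · simp [h]
    · rw [add_tsub_cancel_of_le (hv j h)]
  rw [Finset.sum_congr rfl fun j _ => this j, ← map_sum, ← dLin_apply, h0]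
  simp

theorem linearCombination_aug_homogenize {v : Fin (F.rank 0) → K}
    (hv : ∀ j, v j ≠ 0 → F.shift 0 j ≤ b) :
    Fintype.linearCombination (MvPolynomial (Fin n) K) F.aug (F.homogenize 0 b v) =
      monomial b (F.augLin v) := by
  rw [Fintype.linearCombination_apply, augLin_apply, map_sum]
  refine Finset.sum_congr rfl fun j _ => ?_
  rw [smul_eq_mul, F.aug_eq_monomial j, homogenize, monomial_mul]
  by_cases h : v j = 0
  · simp [h]
  · rw [tsub_add_cancel_of_le (hv j h)]

/-- Equal shifts would make the matrix entry a nonzero constant, contradicting minimality. -/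
theorem shift_lt_of_dCoeff_ne_zero {l : Fin (F.rank i)} {j : Fin (F.rank (i + 1))}
    (h : F.dCoeff i l j ≠ 0) : F.shift i l < F.shift (i + 1) j := by
  have hc := congrArg (coeff (F.shift (i + 1) j)) (F.d_mul_monomial i l j)
  rw [coeff_monomial, if_pos rfl, coeff_mul_monomial'] at hc
  have hle : F.shift i l ≤ F.shift (i + 1) j := by
    by_contra hle
    rw [if_neg hle] at hc
    exact h hc.symm
  refine hle.lt_of_ne fun he => h ?_
  rw [if_pos hle, he, tsub_self, mul_one] at hc
  rw [← hc]
  have := F.minimal i l j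
  rw [← pow_one (Ideal.span _), mem_pow_idealOfVars_iff'] at this
  exact this 0 (by simp)

/-- This is exactness of the resolution in the single multidegree `a - σ`: `homogenize` lifts
vectors into that degree and `strand` reads them off. -/
theorem map_dLin_succ (a : Fin n →₀ ℕ) (σ : Finset (Fin n)) :
    (shiftFamily K (F.shift (i + 2)) a σ).map (F.dLin (i + 1)) =
      shiftFamily K (F.shift (i + 1)) a σ ⊓ LinearMap.ker (F.dLin i) := by
  by_cases hσ : ∀ k ∈ σ, 0 < a k
  · ext v
    rw [Submodule.mem_inf, mem_shiftFamily_iff hσ, Submodule.mem_map]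
    constructor
    · rintro ⟨w, hw, rfl⟩
      rw [mem_shiftFamily_iff hσ] at hw
      rw [← strand_homogenize hw, ← strand_mulVec]
      refine ⟨fun j hj => shift_le_of_strand_ne_zero hj, ?_⟩
      rw [LinearMap.mem_ker, ← strand_mulVec]
      have := (F.exact_succ i _).mpr ⟨F.homogenize (i + 2) (a - sqfreeExponent σ) w, rfl⟩
      rw [Matrix.mulVecLin_apply, Matrix.mulVecLin_apply] at this
      rw [this]
      ext
      simp [strand]
    · rintro ⟨hv, h0⟩
      obtain ⟨w, hw⟩ := (F.exact_succ i _).mp (mulVec_homogenize hv h0)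
      rw [Matrix.mulVecLin_apply] at hw
      refine ⟨F.strand (i + 2) (a - sqfreeExponent σ) w, ?_, ?_⟩
      · rw [mem_shiftFamily_iff hσ]
        exact fun j hj => shift_le_of_strand_ne_zero hj
      · rw [← strand_mulVec, hw, strand_homogenize hv]
  · simp [shiftFamily_eq_bot hσ]

theorem map_dLin_zero (a : Fin n →₀ ℕ) (σ : Finset (Fin n)) :
    (shiftFamily K (F.shift 1) a σ).map (F.dLin 0) =
      shiftFamily K (F.shift 0) a σ ⊓ LinearMap.ker F.augLin := by
  by_cases hσ : ∀ k ∈ σ, 0 < a k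
  · ext v
    rw [Submodule.mem_inf, mem_shiftFamily_iff hσ, Submodule.mem_map]
    constructor
    · rintro ⟨w, hw, rfl⟩
      rw [mem_shiftFamily_iff hσ] at hw
      rw [← strand_homogenize hw, ← strand_mulVec]
      refine ⟨fun j hj => shift_le_of_strand_ne_zero hj, ?_⟩
      rw [LinearMap.mem_ker, ← coeff_linearCombination_aug]
      have := (F.exact_zero _).mpr ⟨F.homogenize 1 (a - sqfreeExponent σ) w, rfl⟩
      rw [Matrix.mulVecLin_apply] at this
      rw [this, coeff_zero]
    · rintro ⟨hv, h0⟩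
      obtain ⟨w, hw⟩ := (F.exact_zero (F.homogenize 0 (a - sqfreeExponent σ) v)).mp (by
        rw [linearCombination_aug_homogenize hv, LinearMap.mem_ker.mp h0, map_zero])
      rw [Matrix.mulVecLin_apply] at hw
      refine ⟨F.strand 1 (a - sqfreeExponent σ) w, ?_, ?_⟩
      · rw [mem_shiftFamily_iff hσ]
        exact fun j hj => shift_le_of_strand_ne_zero hj
      · rw [← strand_mulVec, hw, strand_homogenize hv]
  · simp [shiftFamily_eq_bot hσ]

theorem map_augLin (a : Fin n →₀ ℕ) (σ : Finset (Fin n)) :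
    (shiftFamily K (F.shift 0) a σ).map F.augLin = idealFamily I a σ := by
  by_cases hσ : ∀ k ∈ σ, 0 < a k
  · ext c
    rw [Submodule.mem_map]
    constructor
    · rintro ⟨w, hw, rfl⟩ hne
      rw [mem_shiftFamily_iff hσ] at hw
      refine ⟨hσ, ?_⟩
      have h : monomial (a - sqfreeExponent σ) (F.augLin w) ∈ I := by
        rw [← linearCombination_aug_homogenize hw]
        exact F.range_aug.le ⟨_, rfl⟩
      have h' := I.mul_mem_left (C (F.augLin w)⁻¹) h
      rwa [C_mul_monomial, inv_mul_cancel₀ hne] at h'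
    · intro hc
      by_cases h0 : c = 0
      · exact ⟨0, zero_mem _, by simp [h0]⟩
      obtain ⟨w, hw⟩ := F.range_aug.ge (hc h0).2
      refine ⟨c • F.strand 0 (a - sqfreeExponent σ) w, ?_, ?_⟩
      · refine Submodule.smul_mem _ _ ?_
        rw [mem_shiftFamily_iff hσ]
        exact fun j hj => shift_le_of_strand_ne_zero hj
      · rw [map_smul, ← coeff_linearCombination_aug, hw, coeff_monomial, if_pos rfl, smul_eq_mul,
          mul_one]
  · rw [shiftFamily_eq_bot hσ, Submodule.map_bot, eq_comm, eq_bot_iff]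
    intro c hc
    by_contra h0
    exact hσ (hc h0).1

theorem shift_ne_of_mem_map_dLin {a : Fin n →₀ ℕ} {v : Fin (F.rank i) → K}
    (hv : v ∈ (shiftFamily K (F.shift (i + 1)) a ∅).map (F.dLin i)) (j : Fin (F.rank i))
    (hj : v j ≠ 0) : F.shift i j ≠ a := by
  obtain ⟨w, hw, rfl⟩ := hv
  rw [dLin_apply] at hj
  obtain ⟨l, -, hl⟩ := Finset.exists_ne_zero_of_sum_ne_zero hj
  exact ((shift_lt_of_dCoeff_ne_zero (left_ne_zero_of_mul hl)).trans_le
    (hw l (right_ne_zero_of_mul hl)).1).ne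

/-- Passing to the next syzygy module lowers the homological degree by one; iterating trades
homology of `I` for that of the image of `dLin i`. -/
theorem koszulExact_map_dLin_iff (a : Fin n →₀ ℕ) (i p : ℕ) :
    KoszulExact (idealFamily I a) (p + i + 1) ↔
      KoszulExact (fun σ => (shiftFamily K (F.shift (i + 1)) a σ).map (F.dLin i)) p := by
  induction i generalizing p with
  | zero =>
    rw [← funext (map_augLin (F := F) a), funext (map_dLin_zero (F := F) a)]
    refine koszulExact_map_shiftFamily_succ_iff _ (fun v hv h0 => ?_) p
    exact shift_ne_of_mem_map_dLin ((map_dLin_zero (F := F) a ∅).ge ⟨hv, h0⟩)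
  | succ i ih =>
    rw [show p + (i + 1) + 1 = (p + 1) + i + 1 by lia, ih,
      funext (map_dLin_succ (F := F) (i := i) a)]
    refine koszulExact_map_shiftFamily_succ_iff _ (fun v hv h0 => ?_) p
    exact shift_ne_of_mem_map_dLin ((map_dLin_succ (F := F) a ∅).ge ⟨hv, h0⟩)

/-- The multigraded shifts of a minimal resolution are given by the multigraded Koszul homology
of the ideal. -/
theorem koszulExact_idealFamily_iff (F : MinimalMultigradedResolution I) (a : Fin n →₀ ℕ) (i : ℕ) :
    KoszulExact (idealFamily I a) i ↔ ∀ j, F.shift i j ≠ a := by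
  cases i with
  | zero =>
    rw [← funext (map_augLin (F := F) a)]
    refine koszulExact_map_shiftFamily_zero_iff _ fun v hv h0 => ?_
    exact shift_ne_of_mem_map_dLin ((map_dLin_zero (F := F) a ∅).ge ⟨hv, h0⟩)
  | succ i =>
    have := koszulExact_map_dLin_iff (F := F) a i 0
    rw [zero_add] at this
    rw [this]
    refine koszulExact_map_shiftFamily_zero_iff _ fun v hv h0 => ?_
    exact shift_ne_of_mem_map_dLin ((map_dLin_succ (F := F) a ∅).ge ⟨hv, h0⟩)

end MinimalMultigradedResolution

/-! ### Combinatorics of Borel families and their shift sets. -/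

section BorelFamily

variable {n : ℕ}

/-- The combinatorial data of a squarefree Borel ideal generated in degree `d`: the supports of
its squarefree monomials. -/
structure IsBorelFamily (B : Set (Finset (Fin n))) (d : ℕ) : Prop where
  mono : ∀ {σ τ}, σ ∈ B → σ ⊆ τ → τ ∈ B
  exchange : ∀ {σ i j}, σ ∈ B → j ∈ σ → i ∉ σ → i < j → insert i (σ.erase j) ∈ B
  exists_card_eq : ∀ {σ}, σ ∈ B → ∃ u ⊆ σ, u ∈ B ∧ u.card = d

/-- The supports of the multigraded shifts in homological degree `p` of a squarefree Borel ideal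
generated in degree `d`. -/
def shiftSets (B : Set (Finset (Fin n))) (d p : ℕ) : Set (Finset (Fin n)) :=
  {A | A.card = d + p ∧ ∃ u ⊆ A, u ∈ B ∧ u.card = d ∧ ∀ k ∈ A, ∃ l ∈ u, k ≤ l}

theorem card_insert_erase {A : Finset (Fin n)} {i j : Fin n} (hj : j ∈ A) (hi : i ∉ A) :
    (insert i (A.erase j)).card = A.card := by
  rw [Finset.card_insert_of_notMem fun h => hi (Finset.mem_of_mem_erase h),
    Finset.card_erase_add_one hj]

theorem exists_subset_mem_shiftSets {B : Set (Finset (Fin n))} {d p : ℕ} {A : Finset (Fin n)}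
    (hA : A ∈ shiftSets B d (p + 1)) :
    ∃ A' ⊆ A, A' ∈ shiftSets B d p := by
  obtain ⟨hc, u, huA, hu, hud, hmax⟩ := hA
  obtain ⟨x, hxA, hxu⟩ := Finset.exists_mem_notMem_of_card_lt_card (s := u) (t := A) (by lia)
  refine ⟨A.erase x, Finset.erase_subset _ _, ?_, u, ?_, hu, hud, ?_⟩
  · rw [Finset.card_erase_of_mem hxA, hc]
    lia
  · exact fun y hy => Finset.mem_erase.mpr ⟨fun h => hxu (h ▸ hy), huA hy⟩
  · exact fun k hk => hmax k (Finset.mem_of_mem_erase hk)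

namespace IsBorelFamily

variable {B : Set (Finset (Fin n))} {d p : ℕ}

theorem le_card (hB : IsBorelFamily B d) {σ : Finset (Fin n)} (h : σ ∈ B) : d ≤ σ.card := by
  obtain ⟨u, hu, -, rfl⟩ := hB.exists_card_eq h
  exact Finset.card_le_card hu

theorem exchange_mem_shiftSets (hB : IsBorelFamily B d) {A : Finset (Fin n)}
    (hA : A ∈ shiftSets B d p) {i j : Fin n} (hj : j ∈ A) (hi : i ∉ A) (hij : i < j) :
    insert i (A.erase j) ∈ shiftSets B d p := by
  obtain ⟨hc, u, huA, hu, hud, hmax⟩ := hA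
  refine ⟨by rw [card_insert_erase hj hi, hc], ?_⟩
  have hiu : i ∉ u := fun h => hi (huA h)
  by_cases hju : j ∈ u
  · -- the new generator contains the maximum of the new set
    obtain ⟨m, hm, hmm⟩ := (insert i (A.erase j)).exists_max_image id ⟨i, by simp⟩
    simp only [id] at hmm
    by_cases hmu : m ∈ u
    · refine ⟨insert i (u.erase j), Finset.insert_subset_insert _ (Finset.erase_subset_erase _ huA),
        hB.exchange hu hju hiu hij, by rw [card_insert_erase hju hiu, hud], fun k hk => ?_⟩
      have hmj : m ≠ j := by
        rintro rfl
        simp [hij.ne'] at hm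
      exact ⟨m, by simp [hmu, hmj], hmm k hk⟩
    -- Elements of `u` other than `j` remain in the new set, so are at most `m`. As `m ∉ u`, only
    -- `j` can bound `m` strictly from above.
    · have hmj : m < j := by
        rcases Finset.mem_insert.mp hm with rfl | h
        · exact hij
        · obtain ⟨l, hl, hml⟩ := hmax m (Finset.mem_of_mem_erase h)
          by_cases hlj : l = j
          · subst hlj
            exact lt_of_le_of_ne hml fun h => hmu (h ▸ hl)
          · have := hmm l (by simp [hlj, huA hl])
            exact (hmu (le_antisymm hml this ▸ hl)).elim
      refine ⟨insert m (u.erase j), ?_, hB.exchange hu hju hmu hmj,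
        by rw [card_insert_erase hju hmu, hud], fun k hk => ⟨m, by simp, hmm k hk⟩⟩
      exact Finset.insert_subset hm
        ((Finset.erase_subset_erase _ huA).trans (Finset.subset_insert _ _))
  · refine ⟨u, fun y hy => ?_, hu, hud, fun k hk => ?_⟩
    · exact Finset.mem_insert_of_mem (Finset.mem_erase.mpr ⟨fun h => hju (h ▸ hy), huA hy⟩)
    · rcases Finset.mem_insert.mp hk with rfl | h
      · obtain ⟨l, hl, hjl⟩ := hmax j hj
        exact ⟨l, hl, hij.le.trans hjl⟩
      · exact hmax k (Finset.mem_of_mem_erase h)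

/-- Some element of `A` outside `u` other than `j` can be deleted, unless `A = u ∪ {j}`. Then `p =
0`, and exchanging a larger element of `u` for `j` gives a generator containing `j`. -/
theorem exists_mem_shiftSets_mem (hB : IsBorelFamily B d) {A : Finset (Fin n)}
    (hA : A ∈ shiftSets B d (p + 1)) {j : Fin n} (hj : j ∈ A) :
    ∃ A' ⊆ A, A' ∈ shiftSets B d p ∧ j ∈ A' := by
  obtain ⟨hc, u, huA, hu, hud, hmax⟩ := hA
  by_cases hx : ∃ x ∈ A, x ∉ u ∧ x ≠ j
  · obtain ⟨x, hxA, hxu, hxj⟩ := hx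
    refine ⟨A.erase x, Finset.erase_subset _ _, ⟨?_, u, ?_, hu, hud, ?_⟩,
      Finset.mem_erase.mpr ⟨hxj.symm, hj⟩⟩
    · rw [Finset.card_erase_of_mem hxA, hc]
      lia
    · exact fun y hy => Finset.mem_erase.mpr ⟨fun h => hxu (h ▸ hy), huA hy⟩
    · exact fun k hk => hmax k (Finset.mem_of_mem_erase hk)
  · push Not at hx
    have hAu : A = insert j u := by
      ext y
      rw [Finset.mem_insert]
      refine ⟨fun hy => ?_, ?_⟩
      · by_cases hyu : y ∈ u
        exacts [.inr hyu, .inl (hx y hy hyu)]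
      · rintro (rfl | hy)
        exacts [hj, huA hy]
    have hju : j ∉ u := fun h => by
      rw [hAu, Finset.insert_eq_of_mem h] at hc
      lia
    obtain ⟨m, hmu, hjm⟩ := hmax j hj
    have hjm' : j < m := lt_of_le_of_ne hjm fun h => hju (h ▸ hmu)
    rw [hAu, Finset.card_insert_of_notMem hju] at hc
    refine ⟨insert j (u.erase m), ?_, ⟨?_, _, subset_rfl, hB.exchange hu hmu hju hjm', ?_,
      fun k hk => ⟨k, hk, le_rfl⟩⟩, by simp⟩
    · rw [hAu]
      exact Finset.insert_subset_insert _ (Finset.erase_subset _ _)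
    · rw [card_insert_erase hmu hju]
      lia
    · rw [card_insert_erase hmu hju, hud]

/-- Quotients of monomials in homological degree `p + 1` are generated by quotients of monomials
in homological degree `p`. -/
theorem prod_div_prod_mem (hB : IsBorelFamily B d) {L : Type*} [Field L] {x : Fin n → L}
    (hx : ∀ i, x i ≠ 0) (E : Subfield L)
    (hE : ∀ A ∈ shiftSets B d p, ∀ A' ∈ shiftSets B d p,
      (∏ i ∈ A, x i) / (∏ i ∈ A', x i) ∈ E)
    {A : Finset (Fin n)} (hA : A ∈ shiftSets B d (p + 1)) :
    (∏ i ∈ A, x i) / (∏ i : Fin n with i.val < d + (p + 1), x i) ∈ E := by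
  have ratio : ∀ {C : Finset (Fin n)} {i j : Fin n}, j ∈ C → i ∉ C →
      (∏ l ∈ C, x l) = (x j / x i) * ∏ l ∈ insert i (C.erase j), x l := by
    intro C i j hj hi
    rw [Finset.prod_insert fun h => hi (Finset.mem_of_mem_erase h), ← mul_assoc,
      div_mul_cancel₀ _ (hx i), Finset.mul_prod_erase _ _ hj]
  have hprod : ∀ C : Finset (Fin n), (∏ l ∈ C, x l) ≠ 0 := fun C =>
    Finset.prod_ne_zero_iff.mpr fun i _ => hx i
  -- Each exchange lowers the sum of the indices; when none is possible, `A` is the initial segment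
  -- in the denominator.
  induction hs : ∑ i ∈ A, i.val using Nat.strong_induction_on generalizing A with
  | _ s ih =>
  by_cases h : ∃ j ∈ A, ∃ i ∉ A, i < j
  · obtain ⟨j, hj, i, hi, hij⟩ := h
    rw [ratio hj hi, mul_div_assoc]
    refine mul_mem ?_ (ih _ ?_ (hB.exchange_mem_shiftSets hA hj hi hij) rfl)
    -- The factor `x j / x i` is the quotient of the products over `C` and over `C` with `j`
    -- exchanged for `i`, both in homological degree `p`.
    · obtain ⟨C, hCA, hC, hjC⟩ := hB.exists_mem_shiftSets_mem hA hj
      have hiC : i ∉ C := fun h => hi (hCA h)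
      have := hE C hC _ (hB.exchange_mem_shiftSets hC hjC hiC hij)
      rwa [ratio hjC hiC, mul_div_assoc, div_self (hprod _), mul_one] at this
    · rw [← hs, Finset.sum_insert fun h => hi (Finset.mem_of_mem_erase h),
        ← Finset.add_sum_erase _ _ hj]
      exact Nat.add_lt_add_right hij _
  · push Not at h
    have hle : d + (p + 1) ≤ n := by
      rw [← hA.1]
      simpa using Finset.card_le_univ A
    have : A = Finset.univ.filter fun i : Fin n => i.val < d + (p + 1) := by
      refine Finset.eq_of_subset_of_card_le (fun j hj => ?_) ?_
      · rw [Finset.mem_filter, ← hA.1]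
        refine ⟨Finset.mem_univ _, ?_⟩
        have hsub : Finset.Iic j ⊆ A := fun i hi => by
          by_contra hiA
          exact hiA ((Finset.mem_Iic.mp hi).eq_of_not_lt (not_lt_of_ge (h j hj i hiA)) ▸ hj)
        have := Finset.card_le_card hsub
        rw [Fin.card_Iic] at this
        lia
      · rw [hA.1, Fin.card_filter_val_lt]
        exact min_le_right _ _
    rw [← this, div_self (hprod A)]
    exact one_mem E

end IsBorelFamily

end BorelFamily

/-! ### Koszul homology and shifts of squarefree Borel ideals. -/

section Betti

variable {K : Type*} [Field K] {n : ℕ} {I : Ideal (MvPolynomial (Fin n) K)}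

/-- The supports of the squarefree monomials in `I`. -/
def squarefreeSupports (I : Ideal (MvPolynomial (Fin n) K)) : Set (Finset (Fin n)) :=
  {σ | monomial (sqfreeExponent σ) (1 : K) ∈ I}

theorem monomial_mem_of_le {u v : Fin n →₀ ℕ} (h : u ≤ v) (hu : monomial u (1 : K) ∈ I) :
    monomial v (1 : K) ∈ I := by
  have := I.mul_mem_left (monomial (v - u) (1 : K)) hu
  rwa [monomial_mul, tsub_add_cancel_of_le h, one_mul] at this

theorem sqfreeExponent_support_le (u : Fin n →₀ ℕ) : sqfreeExponent u.support ≤ u := fun i => by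
  rw [sqfreeExponent_apply]
  split_ifs with h
  · exact Nat.one_le_iff_ne_zero.mpr (Finsupp.mem_support_iff.mp h)
  · exact Nat.zero_le _

@[simp]
theorem support_sqfreeExponent (σ : Finset (Fin n)) : (sqfreeExponent σ).support = σ := by
  ext i
  simp

theorem IsKBounded.sqfreeExponent_support {u : Fin n →₀ ℕ} (h : IsKBounded 1 u) :
    sqfreeExponent u.support = u := by
  ext i
  have := h i
  rw [sqfreeExponent_apply]
  split_ifs with hi
  · have := Finsupp.mem_support_iff.mp hi
    lia
  · exact (Finsupp.notMem_support_iff.mp hi).symm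

theorem isKBounded_sqfreeExponent (σ : Finset (Fin n)) : IsKBounded 1 (sqfreeExponent σ) :=
  fun i => by
    rw [sqfreeExponent_apply]
    split_ifs <;> simp

theorem degree_sqfreeExponent (σ : Finset (Fin n)) : (sqfreeExponent σ).degree = σ.card := by
  rw [Finsupp.degree_apply, support_sqfreeExponent, Finset.card_eq_sum_ones]
  exact Finset.sum_congr rfl fun i hi => by simp [hi]

theorem IsSquarefreeBorel.monomial_mem_iff (hI : IsSquarefreeBorel I) (u : Fin n →₀ ℕ) :
    monomial u (1 : K) ∈ I ↔ u.support ∈ squarefreeSupports I := by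
  refine ⟨fun h => ?_, monomial_mem_of_le (sqfreeExponent_support_le u)⟩
  obtain ⟨U, hU, rfl⟩ := hI.generated
  obtain ⟨v, hv, hvu⟩ := mem_ideal_span_monomial_image.mp h u (by simp)
  refine monomial_mem_of_le (u := v) ?_ (Ideal.subset_span (Set.mem_image_of_mem (fun u => monomial u (1 : K)) hv))
  rw [← (hU v hv).sqfreeExponent_support]
  intro i
  have : i ∈ v.support → i ∈ u.support := fun h => Finsupp.support_mono hvu h
  rw [sqfreeExponent_apply, sqfreeExponent_apply]
  split_ifs <;> simp_all

theorem IsSquarefreeBorel.isBorelFamily (hI : IsSquarefreeBorel I) {d : ℕ}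
    (hd : ∀ u ∈ minimalMonomials I, u.degree = d) : IsBorelFamily (squarefreeSupports I) d where
  mono {σ τ} hσ h := by
    refine monomial_mem_of_le (fun i => ?_) hσ
    have := @h i
    rw [sqfreeExponent_apply, sqfreeExponent_apply]
    split_ifs <;> simp_all
  exchange {σ i j} hσ hj hi hij := by
    have e : sqfreeExponent σ - Finsupp.single j 1 + Finsupp.single i 1 =
        sqfreeExponent (insert i (σ.erase j)) := by
      ext l
      simp only [Finsupp.add_apply, Finsupp.tsub_apply, sqfreeExponent_apply,
        Finsupp.single_apply, Finset.mem_insert, Finset.mem_erase]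
      by_cases hli : l = i
      · subst hli
        simp [hi]
      · by_cases hlj : l = j
        · subst hlj
          simp [hj, hli, Ne.symm hli]
        · simp [hli, hlj, Ne.symm hli, Ne.symm hlj]
    have := hI.exchange _ (isKBounded_sqfreeExponent σ) hσ j (by simpa using hj) i hij
    rw [e] at this
    exact this (isKBounded_sqfreeExponent _)
  exists_card_eq {σ} hσ := by
    obtain ⟨v, hv, hmin⟩ := exists_minimal_le_of_wellFoundedLT
      (fun v : Fin n →₀ ℕ => monomial v (1 : K) ∈ I) (sqfreeExponent σ) hσ
    have hb : IsKBounded 1 v := fun i => (hv i).trans (isKBounded_sqfreeExponent σ i)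
    refine ⟨v.support, by simpa using Finsupp.support_mono hv, ?_, ?_⟩
    · rw [← hI.monomial_mem_iff]
      exact hmin.prop
    · rw [← hd v hmin, ← degree_sqfreeExponent, hb.sqfreeExponent_support]

theorem IsSquarefreeBorel.mem_idealFamily_sqfreeExponent (hI : IsSquarefreeBorel I)
    {A σ : Finset (Fin n)} {c : K} :
    c ∈ idealFamily I (sqfreeExponent A) σ ↔
      (c ≠ 0 → σ ⊆ A ∧ A \ σ ∈ squarefreeSupports I) := by
  have h1 : (sqfreeExponent A - sqfreeExponent σ).support = A \ σ := by
    ext i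
    by_cases h : i ∈ A <;> by_cases h' : i ∈ σ <;> simp [h, h']
  have h2 : (∀ k ∈ σ, 0 < sqfreeExponent A k) ↔ σ ⊆ A :=
    forall₂_congr fun k _ => by by_cases h : k ∈ A <;> simp [h]
  rw [← h1, ← hI.monomial_mem_iff, ← h2]
  rfl

theorem koszulExact_of_insert {V : Finset (Fin n) → Submodule K K} {p : ℕ} (k : Fin n)
    (h : ∀ σ, k ∉ σ → σ.card = p → ∀ c ∈ V σ, c ≠ 0 → V (insert k σ) = ⊤) : KoszulExact V p := by
  intro f hf hf0
  have hc : ∀ σ, f σ ≠ 0 → σ.card = p := fun σ hσ => not_imp_comm.mp (hf σ).2 hσ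
  obtain ⟨g, hg, hgf⟩ := exists_koszulD_eq_of_insert (P := fun σ => V σ = ⊤) k hf0 hc
    fun σ hk hσ => h σ hk (hc σ hσ) _ (hf σ).1 hσ
  refine ⟨g, fun σ => ⟨?_, fun hσ => ?_⟩, hgf⟩
  · by_cases h0 : g σ = 0
    · rw [h0]
      exact zero_mem _
    · rw [(hg σ h0).1]
      trivial
  · by_contra h0
    exact hσ (hg σ h0).2

/-- Dividing by `x_k` once leaves `k` in the support, and membership in `I` depends only on the
support, so `k` is a cone point. -/
theorem IsSquarefreeBorel.koszulExact_of_one_lt (hI : IsSquarefreeBorel I) {a : Fin n →₀ ℕ}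
    {k : Fin n} (hk : 1 < a k) (p : ℕ) : KoszulExact (idealFamily I a) p := by
  refine koszulExact_of_insert k fun σ hkσ _ c hc hc0 => ?_
  rw [eq_top_iff]
  rintro c' - -
  obtain ⟨h1, h2⟩ := hc hc0
  refine ⟨fun l hl => ?_, ?_⟩
  · rcases Finset.mem_insert.mp hl with rfl | hl
    exacts [by lia, h1 l hl]
  · rw [hI.monomial_mem_iff] at h2 ⊢
    convert! h2 using 1
    ext l
    simp only [Finsupp.mem_support_iff, Finsupp.tsub_apply, sqfreeExponent_apply,
      Finset.mem_insert]
    by_cases hl : l = k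
    · subst hl
      simp only [true_or, if_true, hkσ, if_false]
      lia
    · simp [hl]

/-- The maximum `m` of `A` serves as cone point. If `σ` could not be enlarged by `m`, every
generator inside `A \ σ` would contain `m`; exchanging `m` for a spare smaller element would avoid
it, so `A \ σ` is itself a generator and `A` a shift set. -/
theorem IsSquarefreeBorel.koszulExact_sqfreeExponent (hI : IsSquarefreeBorel I) {d : ℕ}
    (hB : IsBorelFamily (squarefreeSupports I) d) {A : Finset (Fin n)} {p : ℕ}
    (hA : A ∉ shiftSets (squarefreeSupports I) d p) :
    KoszulExact (idealFamily I (sqfreeExponent A)) p := by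
  rcases A.eq_empty_or_nonempty with rfl | hne
  · intro f hf _
    suffices h : f = 0 from
      ⟨0, fun σ => ⟨zero_mem _, fun _ => rfl⟩, by rw [h]; ext; simp [koszulD]⟩
    ext σ
    by_contra h0
    obtain ⟨h1, h2⟩ := hI.mem_idealFamily_sqfreeExponent.mp (hf σ).1 h0
    have hp : σ.card = p := not_imp_comm.mp (hf σ).2 h0
    obtain rfl := Finset.subset_empty.mp h1
    have hd := hB.le_card h2
    simp only [sdiff_self, Finset.bot_eq_empty, Finset.card_empty] at hd hp h2
    exact hA ⟨by simp; lia, ∅, subset_rfl, h2, by simp; lia, by simp⟩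
  · obtain ⟨m, hm, hmm⟩ := A.exists_max_image id hne
    refine koszulExact_of_insert m fun σ hmσ hp c hc hc0 => ?_
    rw [eq_top_iff]
    rintro c' -
    rw [hI.mem_idealFamily_sqfreeExponent] at hc ⊢
    rintro -
    obtain ⟨h1, h2⟩ := hc hc0
    refine ⟨Finset.insert_subset hm h1, ?_⟩
    have hsd : A \ insert m σ = (A \ σ).erase m := by
      ext l
      simp only [Finset.mem_sdiff, Finset.mem_insert, Finset.mem_erase]
      tauto
    rw [hsd]
    by_contra hcon
    obtain ⟨g, hg, hgB, hgd⟩ := hB.exists_card_eq h2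
    have hmg : m ∈ g := by
      by_contra hmg
      exact hcon (hB.mono hgB fun y hy =>
        Finset.mem_erase.mpr ⟨fun h => hmg (h ▸ hy), hg hy⟩)
    have hgu : g = A \ σ := by
      refine Finset.Subset.antisymm hg fun i hi => ?_
      by_contra hig
      have him : i ≠ m := fun h => hig (h ▸ hmg)
      have hlt : i < m := lt_of_le_of_ne (hmm i (Finset.mem_sdiff.mp hi).1) him
      refine hcon (hB.mono (hB.exchange hgB hmg hig hlt) ?_)
      exact Finset.insert_subset (Finset.mem_erase.mpr ⟨him, hi⟩) (Finset.erase_subset_erase _ hg)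
    refine hA ⟨?_, A \ σ, Finset.sdiff_subset, h2, hgu ▸ hgd, fun k hk => ⟨m, hgu ▸ hmg, hmm k hk⟩⟩
    rw [← Finset.card_sdiff_add_card_eq_card h1, ← hgu, hgd, hp]

/-- Enlarging `σ` would leave fewer than `d` elements, too few for `I`. Hence `σ` is a facet and
every boundary vanishes there. -/
theorem IsSquarefreeBorel.not_koszulExact_of_cycle (hI : IsSquarefreeBorel I) {d : ℕ}
    (hB : IsBorelFamily (squarefreeSupports I) d) {A σ : Finset (Fin n)} {p : ℕ}
    (hA : (A \ σ).card = d) {f : Finset (Fin n) → K}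
    (hf : IsKoszulChain (idealFamily I (sqfreeExponent A)) p f) (hf0 : koszulD f = 0)
    (hσ : f σ ≠ 0) : ¬ KoszulExact (idealFamily I (sqfreeExponent A)) p := by
  intro h
  obtain ⟨g, hg, rfl⟩ := h f hf hf0
  refine hσ (Finset.sum_eq_zero fun j hj => ?_)
  by_contra hne
  replace hne : g (insert j σ) ≠ 0 := fun h => hne (by rw [h, smul_zero])
  obtain ⟨h1, h2⟩ := hI.mem_idealFamily_sqfreeExponent.mp (hg _).1 hne
  have hlt : (A \ insert j σ).card < (A \ σ).card := by
    refine Finset.card_lt_card (Finset.ssubset_iff_of_subset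
      (Finset.sdiff_subset_sdiff subset_rfl (Finset.subset_insert _ _)) |>.mpr ⟨j, ?_, ?_⟩)
    · exact Finset.mem_sdiff.mpr ⟨h1 (Finset.mem_insert_self _ _), by simpa using hj⟩
    · simp
  have := hB.le_card h2
  lia

theorem IsSquarefreeBorel.not_koszulExact (hI : IsSquarefreeBorel I) {d : ℕ}
    (hB : IsBorelFamily (squarefreeSupports I) d) {A : Finset (Fin n)} {p : ℕ}
    (hA : A ∈ shiftSets (squarefreeSupports I) d p) :
    ¬ KoszulExact (idealFamily I (sqfreeExponent A)) p := by
  obtain ⟨hc, u, huA, hu, hud, hmax⟩ := hA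
  have hAu : A \ (A \ u) = u := Finset.sdiff_sdiff_eq_self huA
  have hcard : (A \ u).card = p := by
    rw [Finset.card_sdiff_of_subset huA]
    lia
  rcases A.eq_empty_or_nonempty with rfl | hne
  · obtain rfl := Finset.subset_empty.mp huA
    simp only [sdiff_self, Finset.bot_eq_empty, Finset.card_empty] at hcard hud
    subst hcard
    have hf : IsKoszulChain (idealFamily I (sqfreeExponent (∅ : Finset (Fin n)))) 0
        (Pi.single ∅ (1 : K)) := fun σ => by
      by_cases h : σ = ∅
      · subst h
        refine ⟨hI.mem_idealFamily_sqfreeExponent.mpr fun _ => ⟨subset_rfl, ?_⟩, by simp⟩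
        simpa using hu
      · rw [Pi.single_eq_of_ne h]
        exact ⟨zero_mem _, fun _ => rfl⟩
    exact hI.not_koszulExact_of_cycle hB (σ := ∅) (by simpa using hud) hf hf.koszulD_zero (by simp)
  · obtain ⟨m, hm, hmm⟩ := A.exists_max_image id hne
    have hmu : m ∈ u := by
      obtain ⟨l, hl, hml⟩ := hmax m hm
      obtain rfl : l = m := le_antisymm (hmm l (huA hl)) hml
      exact hl
    have hmσ : m ∉ A \ u := by simp [hmu]
    -- The cycle is the boundary of the simplex `(A \ u) ∪ {m}`. That simplex is not a face, but all
    -- its facets are: omitting `j ≠ m` leaves as complement `u` with `m` exchanged for the smaller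
    -- `j`.
    set e : Finset (Fin n) → K := Pi.single (insert m (A \ u)) 1 with he
    have hsupp : ∀ τ, koszulD e τ ≠ 0 → ∃ j, j ∉ τ ∧ insert j τ = insert m (A \ u) := by
      intro τ hτ
      obtain ⟨j, hj, hj0⟩ := Finset.exists_ne_zero_of_sum_ne_zero hτ
      refine ⟨j, by simpa using hj, ?_⟩
      by_contra hne
      exact hj0 (by rw [he, Pi.single_eq_of_ne hne, smul_zero])
    refine hI.not_koszulExact_of_cycle hB (σ := A \ u) (f := koszulD e) (by rw [hAu, hud]) ?_
      (koszulD_koszulD e) ?_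
    · intro τ
      constructor
      · rw [hI.mem_idealFamily_sqfreeExponent]
        intro hτ
        obtain ⟨j, hj, hjτ⟩ := hsupp τ hτ
        have hτ' : τ = (insert m (A \ u)).erase j := by rw [← hjτ, Finset.erase_insert hj]
        have hjm : j ∈ insert m (A \ u) := hjτ ▸ Finset.mem_insert_self j τ
        have hsub : insert m (A \ u) ⊆ A := Finset.insert_subset hm Finset.sdiff_subset
        refine ⟨hτ' ▸ (Finset.erase_subset _ _).trans hsub, ?_⟩
        rcases Finset.mem_insert.mp hjm with rfl | hju
        · rwa [hτ', Finset.erase_insert hmσ, hAu]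
        · have hju' := (Finset.mem_sdiff.mp hju).2
          have hjA := (Finset.mem_sdiff.mp hju).1
          have hlt : j < m := lt_of_le_of_ne (hmm j hjA) fun h => hju' (h ▸ hmu)
          convert! hB.exchange hu hmu hju' hlt using 1
          ext l
          have := @huA l
          simp only [hτ', Finset.mem_sdiff, Finset.mem_erase, Finset.mem_insert]
          by_cases hlj : l = j
          · subst hlj
            simp [hjA]
          · simp only [hlj, false_or]
            tauto
      · intro hτ
        by_contra h0
        obtain ⟨j, hj, hjτ⟩ := hsupp τ h0
        have := congrArg Finset.card hjτ
        rw [Finset.card_insert_of_notMem hj, Finset.card_insert_of_notMem hmσ] at this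
        lia
    · rw [koszulD, Finset.sum_eq_single_of_mem m (by simpa using hmσ)]
      · rw [he, Pi.single_eq_same]
        intro h0
        have h1 := koszulSign_mul_self m (A \ u)
        have h2 := congrArg (koszulSign m (A \ u) • ·) h0
        simp only [smul_smul, h1, smul_zero, one_smul] at h2
        exact one_ne_zero h2
      · intro j hj hjm
        rw [he, Pi.single_eq_of_ne, smul_zero]
        intro h
        have : j ∈ insert m (A \ u) := h ▸ Finset.mem_insert_self j _
        rcases Finset.mem_insert.mp this with h | h
        exacts [hjm h, (Finset.mem_compl.mp hj) h]

/-- The multigraded shifts of an equigenerated squarefree Borel ideal. -/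
theorem IsSquarefreeBorel.exists_shift_eq_iff (hI : IsSquarefreeBorel I) {d : ℕ}
    (hd : ∀ u ∈ minimalMonomials I, u.degree = d) (F : MinimalMultigradedResolution I) (p : ℕ)
    (a : Fin n →₀ ℕ) :
    (∃ j, F.shift p j = a) ↔ a ∈ sqfreeExponent '' shiftSets (squarefreeSupports I) d p := by
  have hB := hI.isBorelFamily hd
  rw [← not_iff_not, not_exists]
  refine (F.koszulExact_idealFamily_iff a p).symm.trans ?_
  constructor
  · rintro h ⟨A, hA, rfl⟩
    exact hI.not_koszulExact hB hA h
  · intro h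
    by_cases ha : IsKBounded 1 a
    · rw [← ha.sqfreeExponent_support]
      exact hI.koszulExact_sqfreeExponent hB fun hA => h ⟨_, hA, ha.sqfreeExponent_support⟩
    · simp only [IsKBounded, not_forall, not_le] at ha
      obtain ⟨k, hk⟩ := ha
      exact hI.koszulExact_of_one_lt hk p

theorem IsSquarefreeBorel.HS_eq (hI : IsSquarefreeBorel I) {d : ℕ}
    (hd : ∀ u ∈ minimalMonomials I, u.degree = d) (F : MinimalMultigradedResolution I) (p : ℕ) :
    HS p I = monomialIdeal K (sqfreeExponent '' shiftSets (squarefreeSupports I) d p) := by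
  rw [HS, monomialIdeal]
  congr 1
  ext f
  constructor
  · rintro ⟨F', j, rfl⟩
    exact ⟨_, (hI.exists_shift_eq_iff hd F' p _).mp ⟨j, rfl⟩, rfl⟩
  · rintro ⟨a, ha, rfl⟩
    obtain ⟨j, rfl⟩ := (hI.exists_shift_eq_iff hd F p a).mpr ha
    exact ⟨F, j, rfl⟩

theorem HS_eq_bot_of_isEmpty [IsEmpty (MinimalMultigradedResolution I)] (p : ℕ) : HS p I = ⊥ := by
  rw [HS, Ideal.span_eq_bot]
  rintro _ ⟨F, -⟩
  exact isEmptyElim F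

end Betti

/-! ### Comparison of consecutive homological shift ideals. -/

section AnalyticSpread

variable {K : Type*} [Field K] {n : ℕ}

theorem monomial_sqfreeExponent (A : Finset (Fin n)) :
    monomial (sqfreeExponent A) (1 : K) = ∏ i ∈ A, X i := by
  rw [monomial_eq, C_1, one_mul, Finsupp.prod, support_sqfreeExponent]
  exact Finset.prod_congr rfl fun i hi => by simp [hi]

/-- The substitution `T ↦ g T` in a polynomial ring, viewed in the fraction field. -/
noncomputable def scaleHom (g : MvPolynomial (Fin n) K) :
    Polynomial (MvPolynomial (Fin n) K) →ₐ[K]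
      FractionRing (Polynomial (MvPolynomial (Fin n) K)) :=
  (IsScalarTower.toAlgHom K (Polynomial (MvPolynomial (Fin n) K)) _).comp
    ((Polynomial.aeval (Polynomial.C g * Polynomial.X)).restrictScalars K)

theorem scaleHom_monomial_one (g f : MvPolynomial (Fin n) K) :
    scaleHom g (Polynomial.monomial 1 f) =
      algebraMap (Polynomial (MvPolynomial (Fin n) K)) _
        (Polynomial.C f * Polynomial.C g * Polynomial.X) := by
  simp [scaleHom, Polynomial.aeval_monomial, mul_assoc]

theorem scaleHom_injective {g : MvPolynomial (Fin n) K} (hg : g ≠ 0) :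
    Function.Injective (scaleHom g) := by
  refine (IsFractionRing.injective (Polynomial (MvPolynomial (Fin n) K)) _).comp ?_
  rw [injective_iff_map_eq_zero]
  intro p hp
  exact (Polynomial.comp_C_mul_X_eq_zero_iff (mem_nonZeroDivisors_of_ne_zero hg)).mp hp

theorem analyticSpread_shiftSets_le {B : Set (Finset (Fin n))} {d : ℕ} (hB : IsBorelFamily B d)
    (p : ℕ) :
    analyticSpread (monomialIdeal K (sqfreeExponent '' shiftSets B d (p + 1))) ≤
      analyticSpread (monomialIdeal K (sqfreeExponent '' shiftSets B d p)) := by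
  have hdeg : ∀ q, ∀ w ∈ sqfreeExponent '' shiftSets B d q, w.degree = d + q := by
    rintro q _ ⟨A, hA, rfl⟩
    rw [degree_sqfreeExponent, hA.1]
  have hfin : ∀ q, (reesGenerators K (sqfreeExponent '' shiftSets B d q)).Finite := fun q =>
    ((Set.toFinite _).image _).image _
  rw [analyticSpread_monomialIdeal (hdeg _), analyticSpread_monomialIdeal (hdeg _)]
  have hprod : ∀ A : Finset (Fin n), (∏ i ∈ A, X i : MvPolynomial (Fin n) K) ≠ 0 := fun A =>
    Finset.prod_ne_zero_iff.mpr fun i _ => X_ne_zero i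
  rcases (shiftSets B d (p + 1)).eq_empty_or_nonempty with he | ⟨A₀, hA₀⟩
  · refine ringKrullDim_adjoin_le (hfin _) (hfin _) (scaleHom 1) (scaleHom 1)
      (scaleHom_injective one_ne_zero) (scaleHom_injective one_ne_zero) ?_
    rw [he]
    simp
  obtain ⟨B₀, -, hB₀⟩ := exists_subset_mem_shiftSets hA₀
  set R := Polynomial (MvPolynomial (Fin n) K)
  set N : Finset (Fin n) := Finset.univ.filter fun i => i.val < d + (p + 1)
  -- Different rescalings of `T` reconcile the degrees `d + p` and `d + p + 1`: writing `x_C` for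
  -- the product over `C`, one has `x_A x_{B₀} T = (x_A / x_N) (x_{B₀} x_N T)`, where the last
  -- factor is a rescaled generator in degree `p`.
  refine ringKrullDim_adjoin_le (hfin _) (hfin _) (scaleHom (∏ i ∈ N, X i))
    (scaleHom (∏ i ∈ B₀, X i)) (scaleHom_injective (hprod _)) (scaleHom_injective (hprod _)) ?_
  set E := IntermediateField.adjoin K
    (scaleHom (∏ i ∈ N, X i) '' reesGenerators K (sqfreeExponent '' shiftSets B d p))
  let x : Fin n → FractionRing R := fun i => algebraMap R _ (Polynomial.C (X i))
  have hmap : ∀ C : Finset (Fin n),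
      algebraMap R (FractionRing R) (Polynomial.C (∏ i ∈ C, X i)) = ∏ i ∈ C, x i := fun C => by
    rw [map_prod, map_prod]
  have hx : ∀ i, x i ≠ 0 := fun i =>
    (map_ne_zero_iff _ (IsFractionRing.injective R _)).mpr (Polynomial.C_ne_zero.mpr (X_ne_zero i))
  have hxprod : ∀ C : Finset (Fin n), (∏ i ∈ C, x i) ≠ 0 := fun C =>
    Finset.prod_ne_zero_iff.mpr fun i _ => hx i
  have hT : algebraMap R (FractionRing R) Polynomial.X ≠ 0 := by
    simp [R]
  have hgen : ∀ C ∈ shiftSets B d p,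
      (∏ i ∈ C, x i) * (∏ i ∈ N, x i) * algebraMap R (FractionRing R) Polynomial.X ∈ E := by
    intro C hC
    refine IntermediateField.subset_adjoin K _ ⟨_, ⟨_, ⟨C, hC, rfl⟩, rfl⟩, ?_⟩
    rw [scaleHom_monomial_one, monomial_sqfreeExponent, map_mul, map_mul, hmap, hmap]
  rintro _ ⟨_, ⟨A, hA, rfl⟩, rfl⟩
  rw [scaleHom_monomial_one, monomial_sqfreeExponent, map_mul, map_mul, hmap, hmap]
  have hratio := hB.prod_div_prod_mem hx E.toSubfield (fun C hC C' hC' => by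
    have := div_mem (hgen C hC) (hgen C' hC')
    rwa [mul_assoc, mul_assoc, mul_div_mul_right _ _ (mul_ne_zero (hxprod _) hT)] at this) hA
  have h := mul_mem hratio (hgen B₀ hB₀)
  convert! h using 1
  have := hxprod N
  change _ = (∏ i ∈ A, x i) / (∏ i ∈ N, x i) * _
  field_simp
  rfl

theorem monomialIdeal_shiftSets_le (B : Set (Finset (Fin n))) (d p : ℕ) :
    monomialIdeal K (sqfreeExponent '' shiftSets B d (p + 1)) ≤
      monomialIdeal K (sqfreeExponent '' shiftSets B d p) := by
  rw [monomialIdeal, Ideal.span_le]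
  rintro _ ⟨_, ⟨A, hA, rfl⟩, rfl⟩
  obtain ⟨A', hA', h⟩ := exists_subset_mem_shiftSets hA
  refine monomial_mem_of_le (u := sqfreeExponent A') (fun i => ?_)
    (Ideal.subset_span ⟨_, ⟨A', h, rfl⟩, rfl⟩)
  have := @hA' i
  rw [sqfreeExponent_apply, sqfreeExponent_apply]
  split_ifs <;> simp_all

end AnalyticSpread

theorem corollary4p3 {K : Type*} [Field K] {n : ℕ} (I : Ideal (MvPolynomial (Fin n) K))
    (hI : IsSquarefreeBorel I) (hd : IsEquigenerated I) (k : ℕ) :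
    (HS (k + 1) I).height ≤ (HS k I).height ∧
      analyticSpread (HS (k + 1) I) ≤ analyticSpread (HS k I) := by
  obtain ⟨d, hd⟩ := hd
  rcases isEmpty_or_nonempty (MinimalMultigradedResolution I) with h | ⟨⟨F⟩⟩
  -- If there were no resolution, both shift ideals would be zero by definition, so existence need
  -- not be established.
  · simp [HS_eq_bot_of_isEmpty]
  · have hB := hI.isBorelFamily hd
    rw [hI.HS_eq hd F, hI.HS_eq hd F]
    exact ⟨Ideal.height_mono (monomialIdeal_shiftSets_le _ d k), analyticSpread_shiftSets_le hB k⟩
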